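/- Let $p$ be an odd prime, let $n\ge 1$, and let $H = E(x_1,\dots,x_n)\otimes P[y_1,\dots,y_n]$ be the tensor product of an exterior and a polynomial algebra over $\mathbb{Z}/p$, graded by $|x_i|=1$, $|y_i|=2$ (so $H\cong H^*(BV^n;\mathbb{Z}/p)$, where $V^n$ is an $n$-dimensional vector space over $\mathbb{Z}/p$). The mod-$p$ Steenrod algebra $\mathcal{A}$, generated by $\beta$ and the $P^k$, acts on $H$ by $\beta x_i=y_i$, $\beta y_i=0$, $P^0=\mathrm{id}$, $P^k x_i=0$ for $k>0$, $P^1y_i=y_i^p$, $P^ky_i=0$ for $k>1$, and the Cartan formulas. Put: * $d_{n,i}$ ($1\le i\le n$): the Dickson invariants, defined by $\prod_{v}(X-v)=X^{p^n}+\sum_{i=1}^n(-1)^i d_{n,i}X^{p^{n-i}}$, where $v$ runs through all $\mathbb{Z}/p$-linear combinations of $y_1,\dots,y_n$; * $L_n=\det\big(y_j^{p^{i}}\big)_{0\le i\le n-1,\ 1\le j\le n}$; * $M_{n;s_1,\dots,s_m}$ ($0\le s_1<\dots<s_m\le n-1$, $m\le 2$): $\frac1{m!}$ times the determinant (the factors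 of each product ordered by rows) whose first $m$ rows are $(x_1,\dots,x_n)$ and whose remaining rows are $(y_1^{p^t},\dots,y_n^{p^t})$, for $t\in\{0,\dots,n-1\}\setminus\{s_1,\dots,s_m\}$ in increasing order. Let $SD_n\subseteq H$ be the subalgebra generated by all $d_{n,s+1}$, $M_{n;s}L_n^{p-2}$ ($0\le s\le n-1$) and $M_{n;s_1,s_2}L_n^{p-2}$ ($0\le s_1<s_2\le n-1$); let $\overline{SD_n}$ be its part of positive degree; and let $I_n$ be the ideal of $SD_n$ generated by $d_{n,n}$, the $M_{n;i}L_n^{p-2}$ ($0\le i\le n-1$) and the $M_{n;0,i}L_n^{p-2}$ ($1\le i\le n-1$). A graded $\mathcal{A}$-module $N$ is called atomic if every degree preserving $\mathcal{A}$-linear map $f:N\to N$ that is an isomorphism in the lowest positive degree in which $N\neq0$ is an isomorphism. **Proposition.** $SD_n$, $\overline{SD_n}$ and $I_n$ are graded $\mathcal{A}$-submodules of $H$, and: (a) $\overline{SD_n}$ is atomic. Moreover, if a degree preserving $\mathcal{A}$-linear map $f:SD_n\to SD_n$ is an isomorphism in the lowest positive degree in which $SD_n\ne0$, then $f$ is an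 isomorphism in every positive degree, and $f$ is an isomorphism if and only if $f(1)\neq0$. (b) $I_n$ is atomic. -/

import Mathlib

open scoped TensorProduct

noncomputable section

namespace DicksonAtomic

/-- The ring `E(x_1, …, x_n) ⊗ P[y_1, …, y_n]` over `ℤ/p`, which for `p` odd is `H^*(BV^n; ℤ/p)`
(the `y_i` have even degree, so no sign enters the product of the tensor product). -/
abbrev Coh (p n : ℕ) : Type :=
  ExteriorAlgebra (ZMod p) (Fin n → ZMod p) ⊗[ZMod p] MvPolynomial (Fin n) (ZMod p)

variable (p n : ℕ)

/-- The exterior generator `x_i`. -/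
def x (i : Fin n) : Coh p n := ExteriorAlgebra.ι (ZMod p) (Pi.single i (1 : ZMod p)) ⊗ₜ 1

/-- The inclusion of the polynomial subalgebra `P[y_1, …, y_n]`. -/
def incl : MvPolynomial (Fin n) (ZMod p) →ₐ[ZMod p] Coh p n :=
  Algebra.TensorProduct.includeRight

/-- The polynomial generator `y_i`. -/
def y (i : Fin n) : Coh p n := incl p n (MvPolynomial.X i)

/-- The part of degree `d`, where `|x_i| = 1` and `|y_i| = 2`. -/
def degPart (d : ℕ) : Submodule (ZMod p) (Coh p n) :=
  Submodule.span (ZMod p) {z | ∃ (i j : ℕ) (a : ExteriorAlgebra (ZMod p) (Fin n → ZMod p))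
    (b : MvPolynomial (Fin n) (ZMod p)), i + 2 * j = d ∧ a ∈ ⋀[ZMod p]^i (Fin n → ZMod p) ∧
      b.IsHomogeneous j ∧ z = a ⊗ₜ b}

/-! ### The action of the Steenrod algebra -/

/-- The Bockstein `β`: the graded derivation with `β x_i = y_i` and `β y_i = 0`, that is
`∑ i, ∂/∂x_i ⊗ (y_i ·)`, where `∂/∂x_i` is the contraction with the `i`-th coordinate. -/
def bockstein : Coh p n →ₗ[ZMod p] Coh p n :=
  ∑ i : Fin n, TensorProduct.map
    (CliffordAlgebra.contractLeft (Q := (0 : QuadraticForm (ZMod p) (Fin n → ZMod p)))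
      (LinearMap.proj i))
    (LinearMap.mulLeft (ZMod p) (MvPolynomial.X i : MvPolynomial (Fin n) (ZMod p)))

/-- The total reduced power on polynomials: the ring homomorphism with `y_i ↦ y_i + y_i ^ p T`. -/
def totalPower : MvPolynomial (Fin n) (ZMod p) →ₐ[ZMod p]
    Polynomial (MvPolynomial (Fin n) (ZMod p)) :=
  MvPolynomial.aeval fun i =>
    Polynomial.C (MvPolynomial.X i) + Polynomial.C (MvPolynomial.X i ^ p) * Polynomial.X

/-- The reduced power `P^k` on polynomials: the coefficient of `T ^ k` in the total power. -/
def polyPower (k : ℕ) :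
    MvPolynomial (Fin n) (ZMod p) →ₗ[ZMod p] MvPolynomial (Fin n) (ZMod p) :=
  (Polynomial.lcoeff (MvPolynomial (Fin n) (ZMod p)) k).restrictScalars (ZMod p) ∘ₗ
    (totalPower p n).toLinearMap

/-- The reduced power `P^k`. By the Cartan formula and `P^k x_i = 0` for `k > 0`, it is linear over
the exterior algebra. -/
def power (k : ℕ) : Coh p n →ₗ[ZMod p] Coh p n :=
  LinearMap.lTensor (ExteriorAlgebra (ZMod p) (Fin n → ZMod p)) (polyPower p n k)

/-- A graded submodule over the Steenrod algebra `𝒜`, which is generated by `β` and the `P^k`. -/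
structure IsSteenrodSubmodule (N : Submodule (ZMod p) (Coh p n)) : Prop where
  graded : N = ⨆ d, N ⊓ degPart p n d
  bockstein_mem : ∀ z ∈ N, bockstein p n z ∈ N
  power_mem : ∀ k, ∀ z ∈ N, power p n k z ∈ N

variable {p n} in
/-- A degree preserving `𝒜`-linear endomorphism: it preserves the degree and commutes with `β` and
with all `P^k`. -/
structure IsSteenrodEnd {N : Submodule (ZMod p) (Coh p n)} (f : N →ₗ[ZMod p] N) : Prop where
  map_degree : ∀ (d : ℕ) (z : N), (z : Coh p n) ∈ degPart p n d → (f z : Coh p n) ∈ degPart p n d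
  map_bockstein : ∀ z w : N, (w : Coh p n) = bockstein p n z → (f w : Coh p n) = bockstein p n (f z)
  map_power : ∀ (k : ℕ) (z w : N),
    (w : Coh p n) = power p n k z → (f w : Coh p n) = power p n k (f z)

variable {p n} in
/-- `f` is an isomorphism in degree `d`. -/
def IsIsoInDegree {N : Submodule (ZMod p) (Coh p n)} (f : N →ₗ[ZMod p] N) (d : ℕ) : Prop :=
  Set.BijOn f {z | (z : Coh p n) ∈ degPart p n d} {z | (z : Coh p n) ∈ degPart p n d}

variable {p n} in
/-- `r` is the lowest positive degree in which `N` is nonzero. -/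
def IsLowestPositiveDegree (N : Submodule (ZMod p) (Coh p n)) (r : ℕ) : Prop :=
  IsLeast {d : ℕ | 0 < d ∧ N ⊓ degPart p n d ≠ ⊥} r

variable {p n} in
/-- Atomic: every degree preserving `𝒜`-linear endomorphism that is an isomorphism in the lowest
positive degree is an isomorphism. -/
def IsAtomicModule (N : Submodule (ZMod p) (Coh p n)) : Prop :=
  ∀ f : N →ₗ[ZMod p] N, IsSteenrodEnd f →
    ∀ r, IsLowestPositiveDegree N r → IsIsoInDegree f r → Function.Bijective f

/-! ### Invariants of Dickson and Mùi -/

/-- `∏ (X - v)` over all linear forms `v` in `y_1, …, y_n` with coefficients in `ℤ/p`. -/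
def dicksonPoly [NeZero p] : Polynomial (MvPolynomial (Fin n) (ZMod p)) :=
  ∏ v : Fin n → ZMod p, (Polynomial.X - Polynomial.C (∑ j, MvPolynomial.C (v j) * MvPolynomial.X j))

/-- The Dickson invariant `d_{n,i}` of degree `2(p^n - p^{n-i})`, for `1 ≤ i ≤ n`:
`∏ (X - v) = X^{p^n} + ∑_{i=1}^n (-1)^i d_{n,i} X^{p^{n-i}}`. -/
def dickson [NeZero p] (i : ℕ) : Coh p n :=
  incl p n ((-1) ^ i * (dicksonPoly p n).coeff (p ^ (n - i)))

/-- `L_n`, the determinant with rows `y_1^{p^i}, …, y_n^{p^i}` for `i = 0, …, n - 1`. -/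
def L : Coh p n :=
  incl p n (Matrix.det (Matrix.of fun i j : Fin n => MvPolynomial.X j ^ p ^ (i : ℕ)))

variable {p n} in
/-- The determinant of a matrix with entries in a noncommutative ring, the factors of each product
being ordered by rows. -/
def rowDet (A : Matrix (Fin n) (Fin n) (Coh p n)) : Coh p n :=
  ∑ σ : Equiv.Perm (Fin n), (Equiv.Perm.sign σ : ℤ) • (List.ofFn fun i => A i (σ i)).prod

/-- `M_{n;s_1,…,s_m}` for `S = {s_1, …, s_m} ⊆ {0, …, n - 1}` and `m < p`: `1 / m!` times the
determinant whose first `m` rows are `x_1, …, x_n` and whose other rows are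
`y_1^{p^t}, …, y_n^{p^t}`, where `t` runs in increasing order through the elements of
`{0, …, n - 1}` outside `S`. -/
def M (S : Finset ℕ) : Coh p n :=
  ((S.card.factorial : ZMod p))⁻¹ • rowDet (Matrix.of fun i j : Fin n =>
    if (i : ℕ) < S.card then x p n j
    else y p n j ^ p ^ (Nat.nth (fun t => t ∉ S) ((i : ℕ) - S.card)))

/-- `SD_n`, the subalgebra generated by `d_{n,s+1}`, `M_{n;s} L_n^{p-2}` and
`M_{n;s_1,s_2} L_n^{p-2}`. -/
def SD [NeZero p] : Subalgebra (ZMod p) (Coh p n) :=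
  Algebra.adjoin (ZMod p)
    ({z | ∃ s < n, z = dickson p n (s + 1)} ∪ {z | ∃ s < n, z = M p n {s} * L p n ^ (p - 2)} ∪
      {z | ∃ s₁ s₂, s₁ < s₂ ∧ s₂ < n ∧ z = M p n {s₁, s₂} * L p n ^ (p - 2)})

/-- The augmentation ideal of `SD_n`. -/
def augSD [NeZero p] : Submodule (ZMod p) (Coh p n) :=
  Subalgebra.toSubmodule (SD p n) ⊓ ⨆ d : ℕ, degPart p n (d + 1)

/-- `I_n`, the two-sided ideal `SD_n · G · SD_n` of `SD_n` generated by the set `G` of `d_{n,n}`, the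
`M_{n;i} L_n^{p-2}` and the `M_{n;0,i} L_n^{p-2}`. -/
def idealI [NeZero p] : Submodule (ZMod p) (Coh p n) :=
  Subalgebra.toSubmodule (SD p n) *
    Submodule.span (ZMod p)
      ({dickson p n n} ∪ {z | ∃ i < n, z = M p n {i} * L p n ^ (p - 2)} ∪
        {z | ∃ i, 0 < i ∧ i < n ∧ z = M p n {0, i} * L p n ^ (p - 2)}) *
    Subalgebra.toSubmodule (SD p n)

end DicksonAtomic

end

/-!
Let `c_0, …, c_{n-1}` be the coefficients `c_s = ± d_{n,n-s}` of the Dickson polynomial. The Milnor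
primitives, the operations obtained from iterated commutators of the `P^{p^i}` (and from `β` for the
`Q_i`), act on `H` in a very simple way. The `Q_i` strip off the exterior generators, so a nonzero
Steenrod-closed subspace of the positive part of `SD_n` contains a nonzero polynomial `F(c)` with
`F(0) = 0`. On such a polynomial the other primitives act as the operators `-c_0 ∂/∂c_i`, up to
`p`-th powers, and they reduce `F(c)` to powers of `c_0`: the subspace contains `c_0^{p^j}` for all
large `j`. Hence any two nonzero subspaces of this kind intersect.

If `f` is an isomorphism in the lowest positive degree, which is finite, then some power `f^m` is
the identity there, so the kernel of `f^m - 1` is nonzero. It meets the kernel of `f` only in zero,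
so `f` is injective on the elements of augmentation zero, and bijective because every degree is
finite.
-/

noncomputable section

namespace DicksonAtomic

open MvPolynomial (X C)
open scoped Polynomial

section Moore

theorem det_X_pow_ne_zero {R σ : Type*} [CommRing R] [Nontrivial R] [Fintype σ] [DecidableEq σ]
    {e : σ → ℕ} (he : Function.Injective e) :
    (Matrix.of fun i j : σ => (X j : MvPolynomial σ R) ^ e i).det ≠ 0 := by
  have hterm (τ : Equiv.Perm σ) : (τ.sign : ℤ) * ∏ j, (X j : MvPolynomial σ R) ^ e (τ j) =
      MvPolynomial.monomial (Finsupp.equivFunOnFinite.symm (e ∘ τ)) ((τ.sign : ℤ) : R) := by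
    rw [MvPolynomial.monomial_eq, Finsupp.prod_fintype _ _ fun _ => pow_zero _, map_intCast]
    rfl
  have hcoeff : MvPolynomial.coeff (Finsupp.equivFunOnFinite.symm e)
      (Matrix.of fun i j : σ => (X j : MvPolynomial σ R) ^ e i).det = 1 := by
    simp only [Matrix.det_apply', Matrix.of_apply, hterm, MvPolynomial.coeff_sum,
      MvPolynomial.coeff_monomial, EmbeddingLike.apply_eq_iff_eq]
    rw [Finset.sum_eq_single 1 (fun τ _ hτ => if_neg fun h => hτ ?_) (by simp)]
    · simp
    · exact Equiv.ext fun j => he (congrFun h j)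
  intro h
  simp [h] at hcoeff

theorem C_leadingCoeff_mul_prod_X_sub_C_of_injective {R ι : Type*} [CommRing R] [IsDomain R]
    [Fintype ι] {r : ι → R} (hr : Function.Injective r) {Q : R[X]}
    (hdeg : Q.natDegree = Fintype.card ι) (hroot : ∀ i, Q.eval (r i) = 0) :
    Polynomial.C Q.leadingCoeff * ∏ i, (Polynomial.X - Polynomial.C (r i)) = Q := by
  rcases eq_or_ne Q 0 with rfl | hQ
  · simp
  have hroots : Q.roots = (Finset.univ.map ⟨r, hr⟩).val := by
    refine Polynomial.roots_eq_of_natDegree_le_card_of_ne_zero (fun w hw => ?_)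
      (by rw [hdeg, Finset.card_map, Finset.card_univ]) hQ
    obtain ⟨i, -, rfl⟩ := Finset.mem_map.1 hw
    exact hroot i
  have hprod := Polynomial.C_leadingCoeff_mul_prod_multiset_X_sub_C
    ((congrArg Multiset.card hroots).trans
      (((Finset.card_map _).trans Finset.card_univ).trans hdeg.symm))
  rwa [hroots, Finset.map_val, Multiset.map_map] at hprod

/-- The ring `P[y_1, …, y_n]` over `ℤ/p`. -/
abbrev Poly (p n : ℕ) : Type := MvPolynomial (Fin n) (ZMod p)

variable (p n : ℕ)

/-- The Moore matrix, with rows `(y_1 ^ p ^ i, …, y_n ^ p ^ i)` for `i < n`; its determinant is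
`L_n`. -/
def moore : Matrix (Fin n) (Fin n) (Poly p n) :=
  Matrix.of fun i j => X j ^ p ^ (i : ℕ)

/-- The coefficients `c_s` of the relation `y_j ^ p ^ n = ∑ s, c_s y_j ^ p ^ s`. Here
`c_s = (-1) ^ (n - s - 1) d_{n, n - s}`, so that these are the Dickson invariants with the signs
which make the relation above free of signs. -/
def dicksonCoeff [NeZero p] (s : Fin n) : Poly p n := -(dicksonPoly p n).coeff (p ^ (s : ℕ))

/-- The linear form with given coefficients. -/
def linearForm : (Fin n → ZMod p) →ₗ[ZMod p] Poly p n := Fintype.linearCombination (ZMod p) X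

variable {p n}

theorem moore_apply (i j : Fin n) : moore p n i j = X j ^ p ^ (i : ℕ) := rfl

theorem L_eq_incl_det_moore : L p n = incl p n (moore p n).det := rfl

theorem vecMul_moore_apply (a : Fin n → Poly p n) (j : Fin n) :
    Matrix.vecMul a (moore p n) j = ∑ s, a s * X j ^ p ^ (s : ℕ) := rfl

theorem linearForm_apply (v : Fin n → ZMod p) : linearForm p n v = ∑ j, v j • X j := rfl

theorem linearForm_injective : Function.Injective (linearForm p n) :=
  (MvPolynomial.linearIndependent_X _ _).fintypeLinearCombination_injective

theorem dicksonPoly_eq_prod [NeZero p] :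
    dicksonPoly p n = ∏ v, (Polynomial.X - Polynomial.C (linearForm p n v)) := by
  simp only [dicksonPoly, linearForm_apply, MvPolynomial.smul_eq_C_mul]

variable [Fact p.Prime]

theorem det_moore_ne_zero : (moore p n).det ≠ 0 :=
  det_X_pow_ne_zero fun _ _ h =>
    Fin.ext (Nat.pow_right_injective (Fact.out : p.Prime).two_le h)

theorem vecMul_moore_inj {a b : Fin n → Poly p n} :
    Matrix.vecMul a (moore p n) = Matrix.vecMul b (moore p n) ↔ a = b := by
  refine ⟨fun h => sub_eq_zero.1 (Matrix.eq_zero_of_vecMul_eq_zero det_moore_ne_zero ?_),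
    fun h => h ▸ rfl⟩
  rw [Matrix.sub_vecMul, h, sub_self]

theorem linearForm_pow (v : Fin n → ZMod p) (k : ℕ) :
    linearForm p n v ^ p ^ k = ∑ j, v j • X j ^ p ^ k := by
  simp only [linearForm_apply, sum_pow_char_pow, smul_pow, ZMod.pow_card_pow]

/-- A polynomial whose exponents are powers of `p` defines an additive function, so that it
vanishes on all linear forms as soon as it vanishes on the variables. -/
theorem eval_linearForm_eq_zero {a : Fin n → Poly p n} {d : Poly p n}
    (h : Matrix.vecMul a (moore p n) = fun j => d * X j ^ p ^ n) (v : Fin n → ZMod p) :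
    (Polynomial.C d * Polynomial.X ^ p ^ n -
      ∑ s : Fin n, Polynomial.C (a s) * Polynomial.X ^ p ^ (s : ℕ)).eval
        (linearForm p n v) = 0 := by
  simp only [Polynomial.eval_sub, Polynomial.eval_mul, Polynomial.eval_C, Polynomial.eval_pow,
    Polynomial.eval_X, Polynomial.eval_finsetSum, linearForm_pow, Finset.mul_sum, sub_eq_zero]
  rw [Finset.sum_comm]
  refine Finset.sum_congr rfl fun j _ => ?_
  simp only [mul_smul_comm, ← Finset.smul_sum, ← vecMul_moore_apply, h]

theorem C_mul_dicksonPoly {a : Fin n → Poly p n} {d : Poly p n} (hd : d ≠ 0)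
    (h : Matrix.vecMul a (moore p n) = fun j => d * X j ^ p ^ n) :
    Polynomial.C d * dicksonPoly p n = Polynomial.C d * Polynomial.X ^ p ^ n -
      ∑ s : Fin n, Polynomial.C (a s) * Polynomial.X ^ p ^ (s : ℕ) := by
  have hdeg : (∑ s : Fin n, Polynomial.C (a s) * Polynomial.X ^ p ^ (s : ℕ)).degree <
      (Polynomial.C d * Polynomial.X ^ p ^ n).degree := by
    rw [Polynomial.degree_C_mul_X_pow _ hd, ← Polynomial.mem_degreeLT]
    refine sum_mem fun s _ => Polynomial.mem_degreeLT.2 ?_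
    refine (Polynomial.degree_C_mul_X_pow_le _ _).trans_lt ?_
    exact_mod_cast Nat.pow_lt_pow_right (Fact.out : p.Prime).one_lt s.2
  have hnat := (Polynomial.natDegree_eq_of_degree_eq
    (Polynomial.degree_sub_eq_left_of_degree_lt hdeg)).trans
      (Polynomial.natDegree_C_mul_X_pow _ _ hd)
  have hprod := C_leadingCoeff_mul_prod_X_sub_C_of_injective linearForm_injective
    (hnat.trans (by simp [ZMod.card])) (eval_linearForm_eq_zero h)
  rwa [Polynomial.leadingCoeff_sub_of_degree_lt hdeg, Polynomial.leadingCoeff_C_mul_X_pow,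
    ← dicksonPoly_eq_prod] at hprod

theorem mul_dicksonCoeff {a : Fin n → Poly p n} {d : Poly p n} (hd : d ≠ 0)
    (h : Matrix.vecMul a (moore p n) = fun j => d * X j ^ p ^ n) (s : Fin n) :
    d * dicksonCoeff p n s = a s := by
  have hcoeff := congrArg (Polynomial.coeff · (p ^ (s : ℕ))) (C_mul_dicksonPoly hd h)
  have hlt := Nat.pow_lt_pow_right (Fact.out : p.Prime).one_lt s.2
  have hinj (t : Fin n) : p ^ (s : ℕ) = p ^ (t : ℕ) ↔ s = t :=
    ((Nat.pow_right_injective (Fact.out : p.Prime).two_le).eq_iff).trans Fin.val_inj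
  simp only [Polynomial.coeff_C_mul, Polynomial.coeff_sub, Polynomial.coeff_X_pow,
    Polynomial.finsetSum_coeff, hlt.ne, hinj] at hcoeff
  simp [dicksonCoeff, hcoeff]

theorem vecMul_adjugate_moore_vecMul_moore :
    Matrix.vecMul (Matrix.vecMul (fun j => X j ^ p ^ n) (moore p n).adjugate) (moore p n) =
      fun j => (moore p n).det * X j ^ p ^ n := by
  rw [Matrix.vecMul_vecMul, Matrix.adjugate_mul, Matrix.vecMul_smul, Matrix.vecMul_one]
  rfl

theorem det_moore_mul_dicksonCoeff (s : Fin n) :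
    (moore p n).det * dicksonCoeff p n s =
      Matrix.vecMul (fun j => X j ^ p ^ n) (moore p n).adjugate s :=
  mul_dicksonCoeff det_moore_ne_zero vecMul_adjugate_moore_vecMul_moore s

theorem dicksonCoeff_vecMul_moore :
    Matrix.vecMul (dicksonCoeff p n) (moore p n) = fun j => X j ^ p ^ n := by
  refine funext fun j => mul_left_cancel₀ (det_moore_ne_zero (p := p) (n := n)) ?_
  rw [← congrFun vecMul_adjugate_moore_vecMul_moore j, vecMul_moore_apply, vecMul_moore_apply,
    Finset.mul_sum]
  simp only [← det_moore_mul_dicksonCoeff, mul_assoc]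

end Moore

section Companion

variable {n : ℕ}

/-- The companion matrix with last row `c`. -/
def companion {R : Type*} [Zero R] [One R] (c : Fin n → R) : Matrix (Fin n) (Fin n) R :=
  Matrix.of fun i => if h : (i : ℕ) + 1 < n then Pi.single ⟨i + 1, h⟩ 1 else c

theorem companion_row {R : Type*} [Zero R] [One R] (c : Fin n → R) (i : Fin n) :
    companion c i = if h : (i : ℕ) + 1 < n then Pi.single ⟨i + 1, h⟩ 1 else c := rfl

theorem map_companion {R S F : Type*} [NonAssocSemiring R] [NonAssocSemiring S] [FunLike F R S]
    [RingHomClass F R S] (f : F) (c : Fin n → R) :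
    (companion c).map f = companion (f ∘ c) := by
  ext i j
  simp only [Matrix.map_apply, companion, Matrix.of_apply]
  split_ifs <;> simp [Pi.single_apply, apply_ite f]

theorem companion_eq_submatrix [NeZero n] {R : Type*} [Zero R] [One R] (c : Fin n → R) :
    companion c = ((1 : Matrix (Fin n) (Fin n) R).updateRow 0 c).submatrix (finRotate n) id := by
  obtain ⟨m, rfl⟩ := Nat.exists_eq_succ_of_ne_zero (NeZero.ne n)
  ext i j
  simp only [companion, Matrix.of_apply, Matrix.submatrix_apply, id]
  split_ifs with h
  · have hi : finRotate (m + 1) i = ⟨i + 1, h⟩ := finRotate_of_lt (Nat.lt_of_succ_lt_succ h)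
    rw [hi, Matrix.updateRow_ne (Fin.ne_of_val_ne (Nat.succ_ne_zero _)),
      Matrix.one_apply, Pi.single_apply]
    simp only [eq_comm]
  · obtain rfl : i = Fin.last m := Fin.ext (by rw [Fin.val_last]; omega)
    rw [finRotate_last, Matrix.updateRow_self]

theorem det_companion [NeZero n] {R : Type*} [CommRing R] (c : Fin n → R) :
    (companion c).det = ((finRotate n).sign : ℤ) * c 0 := by
  rw [companion_eq_submatrix, Matrix.det_permute, ← Matrix.cramer_transpose_apply,
    Matrix.transpose_one, Matrix.cramer_one]
  rfl

variable {p : ℕ} [Fact p.Prime]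

theorem companion_mul_moore_apply (i j : Fin n) :
    (companion (dicksonCoeff p n) * moore p n) i j = X j ^ p ^ ((i : ℕ) + 1) := by
  rw [Matrix.mul_apply_eq_vecMul, companion_row]
  split_ifs with h
  · rw [Matrix.single_one_vecMul]
    rfl
  · rw [dicksonCoeff_vecMul_moore, show (i : ℕ) + 1 = n by omega]

theorem companion_mul_moore :
    companion (dicksonCoeff p n) * moore p n = (moore p n).map (frobenius (Poly p n) p) := by
  ext i j : 1
  rw [companion_mul_moore_apply, Matrix.map_apply, frobenius_def, moore_apply, ← pow_mul, pow_succ]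

theorem dicksonCoeff_zero_eq [NeZero n] :
    dicksonCoeff p n 0 = ((finRotate n).sign : ℤ) * (moore p n).det ^ (p - 1) := by
  refine mul_left_cancel₀ (det_moore_ne_zero (p := p) (n := n)) ?_
  have hdet := congrArg Matrix.det (companion_mul_moore (p := p) (n := n))
  rw [Matrix.det_mul, det_companion] at hdet
  rw [mul_left_comm, mul_pow_sub_one (Fact.out : p.Prime).ne_zero, ← frobenius_def,
    RingHom.map_det, RingHom.mapMatrix_apply, ← hdet, ← mul_assoc, ← mul_assoc, ← Int.cast_mul,
    ← Units.val_mul, Int.units_mul_self, mul_comm]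
  simp

theorem dicksonCoeff_zero_ne_zero [NeZero n] : dicksonCoeff p n 0 ≠ 0 := fun h => by
  have hdet := dicksonCoeff_zero_eq (p := p) (n := n)
  rw [h, eq_comm, ← zsmul_eq_mul, ← Units.smul_def, smul_eq_zero_iff_eq] at hdet
  exact pow_ne_zero _ det_moore_ne_zero hdet

end Companion

section PowerMatrix

variable {p n : ℕ} {R S : Type*} [CommRing R] [CommRing S]

theorem coeff_mem_range_of_mul_map_eq_map {f : R →+* S} {g h : R[X]} {a : S[X]}
    (hh : IsUnit (h.coeff 0)) (e : a * h.map f = g.map f) (k : ℕ) : a.coeff k ∈ f.range := by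
  obtain ⟨u, hu⟩ : ∃ u, (h : PowerSeries R) * u = 1 :=
    (PowerSeries.isUnit_iff_constantCoeff.2 (by simpa using hh)).exists_right_inv
  have ha : (a : PowerSeries S) = PowerSeries.map f (g * u) := by
    rw [map_mul, ← Polynomial.polynomial_map_coe, ← e, Polynomial.coe_mul, mul_assoc,
      Polynomial.polynomial_map_coe, ← map_mul, hu, map_one, mul_one]
  rw [← Polynomial.coeff_coe, ha, PowerSeries.coeff_map]
  exact ⟨_, rfl⟩

variable (p) in
/-- The matrix by which the total power acts on the Moore matrix when `c` is the row of the
coefficients `dicksonCoeff`. -/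
def powerMatrix (c : Fin n → R) : Matrix (Fin n) (Fin n) R[X] :=
  1 + Matrix.diagonal (fun i : Fin n => Polynomial.X ^ p ^ (i : ℕ)) *
    (companion c).map Polynomial.C

theorem powerMatrix_apply (c : Fin n → R) (i j : Fin n) :
    powerMatrix p c i j = (1 : Matrix (Fin n) (Fin n) R[X]) i j +
      Polynomial.X ^ p ^ (i : ℕ) * Polynomial.C (companion c i j) := by
  rw [powerMatrix, Matrix.add_apply, Matrix.diagonal_mul, Matrix.map_apply]

theorem mapMatrix_powerMatrix (f : R →+* S) (c : Fin n → R) :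
    (Polynomial.mapRingHom f).mapMatrix (powerMatrix p c) = powerMatrix p (f ∘ c) := by
  ext i j : 1
  simp [powerMatrix_apply, ← map_companion, Matrix.one_apply, apply_ite (Polynomial.map f)]

theorem det_powerMatrix_comp (f : R →+* S) (c : Fin n → R) :
    (powerMatrix p (f ∘ c)).det = (powerMatrix p c).det.map f := by
  rw [← mapMatrix_powerMatrix, ← RingHom.map_det, Polynomial.coe_mapRingHom]

theorem adjugate_powerMatrix_comp (f : R →+* S) (c : Fin n → R) (i j : Fin n) :
    (powerMatrix p (f ∘ c)).adjugate i j = ((powerMatrix p c).adjugate i j).map f := by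
  rw [← mapMatrix_powerMatrix, ← RingHom.map_adjugate]
  rfl

theorem coeff_zero_det_powerMatrix (hp : p ≠ 0) (c : Fin n → R) :
    (powerMatrix p c).det.coeff 0 = 1 := by
  have hone : Polynomial.constantCoeff.mapMatrix (powerMatrix p c) = 1 := by
    ext i j
    simp [powerMatrix_apply, Matrix.one_apply, apply_ite (Polynomial.coeff · 0),
      Polynomial.coeff_X_pow, (pow_ne_zero _ hp).symm]
  rw [← Polynomial.constantCoeff_apply, RingHom.map_det, hone, Matrix.det_one]

theorem C_dvd_adjugate_powerMatrix [NeZero n] (c : Fin n → R) {i : Fin n} (hi : i ≠ 0) :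
    Polynomial.C (c 0) ∣ (powerMatrix p c).adjugate i 0 := by
  have hcol (t : Fin n) : Polynomial.C (c 0) ∣
      powerMatrix p c t 0 - (1 : Matrix (Fin n) (Fin n) R[X]) t 0 := by
    rw [powerMatrix_apply, add_sub_cancel_left, companion_row]
    split_ifs with h
    · rw [Pi.single_eq_of_ne (Fin.ne_of_val_ne (Nat.succ_ne_zero _).symm), map_zero, mul_zero]
      exact dvd_zero _
    · exact Dvd.intro_left _ rfl
  have hsum : (powerMatrix p c).adjugate i 0 = -∑ t, (powerMatrix p c).adjugate i t *
      (powerMatrix p c t 0 - (1 : Matrix (Fin n) (Fin n) R[X]) t 0) := by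
    simp only [mul_sub, Finset.sum_sub_distrib, ← Matrix.mul_apply, Matrix.adjugate_mul, mul_one]
    rw [Matrix.smul_apply, Matrix.one_apply_ne hi, smul_zero, zero_sub, neg_neg]
  rw [hsum, dvd_neg]
  exact Finset.dvd_sum fun t _ => (hcol t).mul_left _

end PowerMatrix

section TotalPower

variable {p n : ℕ} [Fact p.Prime]

theorem totalPower_X_pow (j : Fin n) (k : ℕ) :
    totalPower p n (X j ^ p ^ k) = Polynomial.C (X j ^ p ^ k) +
      Polynomial.X ^ p ^ k * Polynomial.C (X j ^ p ^ (k + 1)) := by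
  rw [map_pow, totalPower, MvPolynomial.aeval_X, add_pow_char_pow, mul_pow, ← Polynomial.C_pow,
    ← Polynomial.C_pow, ← pow_mul, ← pow_succ', mul_comm (Polynomial.C _)]

theorem mapMatrix_totalPower_moore :
    (totalPower p n).mapMatrix (moore p n) =
      powerMatrix p (dicksonCoeff p n) * Polynomial.C.mapMatrix (moore p n) := by
  ext i j : 1
  rw [AlgHom.mapMatrix_apply, Matrix.map_apply, moore_apply, totalPower_X_pow,
    ← companion_mul_moore_apply, powerMatrix, add_mul, one_mul, mul_assoc, Matrix.add_apply,
    Matrix.diagonal_mul, RingHom.mapMatrix_apply, ← Matrix.map_mul]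
  rfl

theorem totalPower_det_moore :
    totalPower p n (moore p n).det =
      (powerMatrix p (dicksonCoeff p n)).det * Polynomial.C (moore p n).det := by
  rw [AlgHom.map_det, mapMatrix_totalPower_moore, Matrix.det_mul, RingHom.map_det]

theorem totalPower_adjugate_moore (j s : Fin n) :
    totalPower p n ((moore p n).adjugate j s) =
      ∑ t, Polynomial.C ((moore p n).adjugate j t) *
        (powerMatrix p (dicksonCoeff p n)).adjugate t s := by
  have h := AlgHom.map_adjugate (totalPower p n) (moore p n)
  rw [mapMatrix_totalPower_moore, Matrix.adjugate_mul_distrib, ← RingHom.map_adjugate] at h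
  exact (congrFun (congrFun h j) s).trans (Matrix.mul_apply ..)

theorem frobenius_dicksonCoeff_vecMul_companion_vecMul_moore :
    Matrix.vecMul (Matrix.vecMul (frobenius _ p ∘ dicksonCoeff p n)
      (companion (dicksonCoeff p n))) (moore p n) = fun j => X j ^ p ^ (n + 1) := by
  ext1 j
  rw [Matrix.vecMul_vecMul, companion_mul_moore, ← RingHom.map_vecMul, dicksonCoeff_vecMul_moore,
    frobenius_def, ← pow_mul, pow_succ]

theorem totalPower_dicksonCoeff_vecMul_powerMatrix :
    Matrix.vecMul (totalPower p n ∘ dicksonCoeff p n) (powerMatrix p (dicksonCoeff p n)) =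
      fun t => Polynomial.C (dicksonCoeff p n t) + Polynomial.X ^ p ^ n * Polynomial.C
        (Matrix.vecMul (frobenius _ p ∘ dicksonCoeff p n) (companion (dicksonCoeff p n)) t) := by
  have hdet : (Polynomial.C.mapMatrix (moore p n)).det ≠ 0 := by
    rw [← RingHom.map_det]
    exact Polynomial.C_ne_zero.2 det_moore_ne_zero
  refine sub_eq_zero.1 (Matrix.eq_zero_of_vecMul_eq_zero hdet ?_)
  rw [Matrix.sub_vecMul, Matrix.vecMul_vecMul, ← mapMatrix_totalPower_moore, sub_eq_zero]
  ext1 j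
  have hrel := RingHom.map_vecMul (totalPower p n).toRingHom (moore p n) (dicksonCoeff p n) j
  rw [dicksonCoeff_vecMul_moore] at hrel
  refine hrel.symm.trans ((totalPower_X_pow j n).trans ?_)
  rw [← congrFun frobenius_dicksonCoeff_vecMul_companion_vecMul_moore j,
    ← congrFun dicksonCoeff_vecMul_moore j, RingHom.map_vecMul, RingHom.map_vecMul,
    ← smul_eq_mul, ← Pi.smul_apply, ← Matrix.smul_vecMul, ← Pi.add_apply, ← Matrix.add_vecMul]
  rfl

variable (p n) in
/-- The Dickson algebra `(ℤ/p)[d_{n,1}, …, d_{n,n}]`. -/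
def dicksonAlgebra : Subalgebra (ZMod p) (Poly p n) :=
  Algebra.adjoin (ZMod p) (Set.range (dicksonCoeff p n))

variable (p n) in
/-- The coefficients `dicksonCoeff` as elements of the Dickson algebra. -/
def dicksonGen (s : Fin n) : dicksonAlgebra p n :=
  ⟨dicksonCoeff p n s, Algebra.subset_adjoin ⟨s, rfl⟩⟩

theorem coeff_totalPower_dicksonCoeff_mem (s : Fin n) (k : ℕ) :
    (totalPower p n (dicksonCoeff p n s)).coeff k ∈ dicksonAlgebra p n := by
  let ι : dicksonAlgebra p n →+* Poly p n := algebraMap _ _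
  let g (t : Fin n) : (dicksonAlgebra p n)[X] := Polynomial.C (dicksonGen p n t) +
    Polynomial.X ^ p ^ n * Polynomial.C
      (Matrix.vecMul (fun s => dicksonGen p n s ^ p) (companion (dicksonGen p n)) t)
  have hg : Matrix.vecMul (totalPower p n ∘ dicksonCoeff p n)
      (powerMatrix p (ι ∘ dicksonGen p n)) = Polynomial.mapRingHom ι ∘ g := by
    refine totalPower_dicksonCoeff_vecMul_powerMatrix.trans (funext fun t => ?_)
    have hcomp : ι (Matrix.vecMul (fun s => dicksonGen p n s ^ p) (companion (dicksonGen p n)) t) =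
        Matrix.vecMul (frobenius _ p ∘ dicksonCoeff p n) (companion (dicksonCoeff p n)) t := by
      rw [RingHom.map_vecMul, map_companion]
      rfl
    simp only [Function.comp_apply, g, Polynomial.coe_mapRingHom, Polynomial.map_add,
      Polynomial.map_mul, Polynomial.map_pow, Polynomial.map_C, Polynomial.map_X, hcomp]
    rfl
  have hmul : totalPower p n (dicksonCoeff p n s) * (powerMatrix p (dicksonGen p n)).det.map ι =
      (Matrix.vecMul g (powerMatrix p (dicksonGen p n)).adjugate s).map ι := by
    have h := congrFun (congrArg
      (Matrix.vecMul · (powerMatrix p (ι ∘ dicksonGen p n)).adjugate) hg) s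
    rw [Matrix.vecMul_vecMul, Matrix.mul_adjugate, Matrix.vecMul_smul, Matrix.vecMul_one,
      ← mapMatrix_powerMatrix, ← RingHom.map_adjugate, RingHom.mapMatrix_apply,
      RingHom.mapMatrix_apply, ← RingHom.map_vecMul, ← RingHom.mapMatrix_apply,
      ← RingHom.map_det] at h
    rwa [mul_comm]
  obtain ⟨d, hd⟩ := coeff_mem_range_of_mul_map_eq_map
    (coeff_zero_det_powerMatrix (Fact.out : p.Prime).ne_zero (dicksonGen p n) ▸ isUnit_one) hmul k
  exact hd ▸ d.2

theorem coeff_totalPower_mem {q : Poly p n} (hq : q ∈ dicksonAlgebra p n) (k : ℕ) :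
    (totalPower p n q).coeff k ∈ dicksonAlgebra p n := by
  suffices totalPower p n q ∈ Polynomial.lifts (algebraMap (dicksonAlgebra p n) (Poly p n)) by
    obtain ⟨d, hd⟩ := (Polynomial.lifts_iff_coeff_lifts _).1 this k
    exact hd ▸ d.2
  induction hq using Algebra.adjoin_induction with
  | mem _ h =>
    obtain ⟨s, rfl⟩ := h
    exact (Polynomial.lifts_iff_coeff_lifts _).2 fun k =>
      ⟨⟨_, coeff_totalPower_dicksonCoeff_mem s k⟩, rfl⟩
  | algebraMap r =>
    rw [AlgHom.commutes]
    exact Polynomial.C_mem_lifts _ (algebraMap (ZMod p) (dicksonAlgebra p n) r)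
  | add _ _ _ _ h₁ h₂ => exact map_add (totalPower p n) .. ▸ add_mem h₁ h₂
  | mul _ _ _ _ h₁ h₂ => exact map_mul (totalPower p n) .. ▸ mul_mem h₁ h₂

end TotalPower

section PartialDerivatives

variable {σ K : Type*}

theorem pderiv_pderiv_comm [CommRing K] (i j : σ) (F : MvPolynomial σ K) :
    MvPolynomial.pderiv i (MvPolynomial.pderiv j F) =
      MvPolynomial.pderiv j (MvPolynomial.pderiv i F) := by
  classical
  have h : ⁅MvPolynomial.pderiv (R := K) i, MvPolynomial.pderiv (R := K) j⁆ = 0 := by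
    refine MvPolynomial.derivation_ext fun s => ?_
    simp [Derivation.commutator_apply, MvPolynomial.pderiv_X, Pi.single_apply,
      apply_ite (MvPolynomial.pderiv _)]
  rw [← sub_eq_zero, ← Derivation.commutator_apply, h, Derivation.zero_apply]

theorem derivation_aeval [CommSemiring K] [Fintype σ] {A M : Type*} [CommSemiring A] [Algebra K A]
    [AddCommMonoid M] [Module A M] [Module K M] (d : Derivation K A M) (f : σ → A)
    (F : MvPolynomial σ K) :
    d (MvPolynomial.aeval f F) =
      ∑ s, MvPolynomial.aeval f (MvPolynomial.pderiv s F) • d (f s) := by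
  classical
  induction F using MvPolynomial.induction_on with
  | C a => simp
  | add F G hF hG => simp [hF, hG, add_smul, Finset.sum_add_distrib]
  | mul_X F j hF =>
    simp [hF, MvPolynomial.pderiv_X, Pi.single_apply, add_smul, mul_smul, Finset.sum_add_distrib,
      Finset.smul_sum, apply_ite (MvPolynomial.aeval f), ite_smul, mul_ite]

theorem exists_expand_eq_of_pderiv_eq_zero [CommSemiring K] [NoZeroDivisors K] (p : ℕ) [CharP K p]
    {F : MvPolynomial σ K} (h : ∀ i, MvPolynomial.pderiv i F = 0) :
    ∃ G, MvPolynomial.expand p G = F := by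
  have hdvd (d : σ →₀ ℕ) (hd : d ∈ F.support) (i : σ) : p ∣ d i := by
    rcases Nat.eq_zero_or_pos (d i) with hi | hi
    · exact hi ▸ dvd_zero p
    have hcoeff := MvPolynomial.coeff_pderiv (i := i) F (d - Finsupp.single i 1)
    rw [h i, MvPolynomial.coeff_zero, tsub_add_cancel_of_le (Finsupp.single_le_iff.2 hi), eq_comm,
      mul_eq_zero_iff_left (MvPolynomial.mem_support_iff.1 hd), Finsupp.tsub_apply,
      Finsupp.single_eq_same, ← Nat.cast_add_one, Nat.sub_add_cancel hi] at hcoeff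
    exact (CharP.cast_eq_zero_iff K p _).1 hcoeff
  refine ⟨∑ d ∈ F.support, MvPolynomial.monomial (d.mapRange (· / p) (Nat.zero_div p))
    (F.coeff d), ?_⟩
  rw [map_sum]
  conv_rhs => rw [F.as_sum]
  refine Finset.sum_congr rfl fun d hd => ?_
  rw [MvPolynomial.expand_monomial]
  congr 2
  ext i
  simp [Nat.mul_div_cancel' (hdvd d hd i)]

section WeightedDegree

variable [CommSemiring K] (w : σ → ℕ)

theorem weightedTotalDegree_pderiv_add_le {i : σ} {F : MvPolynomial σ K}
    (h : MvPolynomial.pderiv i F ≠ 0) :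
    (MvPolynomial.pderiv i F).weightedTotalDegree w + w i ≤ F.weightedTotalDegree w := by
  obtain ⟨d, hd, hsup⟩ := Finset.exists_mem_eq_sup _ (MvPolynomial.support_nonempty.2 h)
    (Finsupp.weight w)
  have hmem : d + Finsupp.single i 1 ∈ F.support := by
    rw [MvPolynomial.mem_support_iff, MvPolynomial.coeff_pderiv] at hd
    exact MvPolynomial.mem_support_iff.2 (left_ne_zero_of_mul hd)
  rw [MvPolynomial.weightedTotalDegree, hsup]
  simpa [Finsupp.weight_single] using MvPolynomial.le_weightedTotalDegree w hmem

theorem weightedTotalDegree_X_mul_le (i : σ) (F : MvPolynomial σ K) :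
    (X i * F).weightedTotalDegree w ≤ F.weightedTotalDegree w + w i := by
  refine Finset.sup_le fun d hd => ?_
  rw [MvPolynomial.support_X_mul, Finset.mem_map] at hd
  obtain ⟨e, he, rfl⟩ := hd
  simpa [Finsupp.weight_single, add_comm] using MvPolynomial.le_weightedTotalDegree w he

theorem weightedTotalDegree_expand {p : ℕ} (hp : p ≠ 0) (F : MvPolynomial σ K) :
    (MvPolynomial.expand p F).weightedTotalDegree w = F.weightedTotalDegree w * p := by
  classical
  rw [MvPolynomial.weightedTotalDegree, MvPolynomial.support_expand F hp, Finset.sup_image,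
    MvPolynomial.weightedTotalDegree, Finset.sup_mul₀]
  exact Finset.sup_congr rfl fun d _ => by simp [mul_comm]

/-- The operator `X_i ^ 2 ∂/∂X_i`. -/
def sqEuler (i : σ) : MvPolynomial σ K →ₗ[K] MvPolynomial σ K :=
  LinearMap.mulLeft K (X i ^ 2) ∘ₗ (MvPolynomial.pderiv i).toLinearMap

theorem sqEuler_apply (i : σ) (F : MvPolynomial σ K) :
    sqEuler i F = X i ^ 2 * MvPolynomial.pderiv i F := rfl

theorem weightedTotalDegree_sqEuler_iterate_le (i : σ) (F : MvPolynomial σ K) (j : ℕ) :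
    ((sqEuler i)^[j] F).weightedTotalDegree w ≤ F.weightedTotalDegree w + j * w i := by
  induction j with
  | zero => simp
  | succ j ih =>
    rw [Function.iterate_succ_apply', sqEuler_apply, pow_two, mul_assoc]
    set G := (sqEuler i)^[j] F
    by_cases hG : MvPolynomial.pderiv i G = 0
    · simp [hG, MvPolynomial.weightedTotalDegree_zero]
    · have hX := weightedTotalDegree_X_mul_le w i (X i * MvPolynomial.pderiv i G)
      have hX' := weightedTotalDegree_X_mul_le w i (MvPolynomial.pderiv i G)
      have hderiv := weightedTotalDegree_pderiv_add_le w hG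
      rw [add_mul]
      omega

theorem sqEuler_iterate_monomial (i : σ) (d : σ →₀ ℕ) (a : K) (j : ℕ) :
    (sqEuler i)^[j] (MvPolynomial.monomial d a) =
      MvPolynomial.monomial (d + Finsupp.single i j) (a * ((d i).ascFactorial j : ℕ)) := by
  induction j with
  | zero => simp
  | succ j ih =>
    rw [Function.iterate_succ_apply', ih, sqEuler_apply, MvPolynomial.pderiv_monomial,
      MvPolynomial.X_pow_eq_monomial, MvPolynomial.monomial_mul, one_mul, Finsupp.add_apply,
      Finsupp.single_eq_same, mul_assoc, ← Nat.cast_mul, mul_comm (Nat.ascFactorial _ _),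
      ← Nat.ascFactorial_succ]
    rcases Nat.eq_zero_or_pos (d i + j) with hzero | hpos
    · simp [Nat.ascFactorial_succ, hzero]
    · suffices Finsupp.single i 2 + (d + Finsupp.single i j - Finsupp.single i 1) =
          d + Finsupp.single i (j + 1) by rw [this]
      ext s
      rcases eq_or_ne i s with rfl | hs
      · simp only [Finsupp.add_apply, Finsupp.tsub_apply, Finsupp.single_eq_same]
        omega
      · simp [hs.symm]

theorem sqEuler_iterate_prime (p : ℕ) [Fact p.Prime] [CharP K p] (i : σ) (F : MvPolynomial σ K) :
    (sqEuler i)^[p] F = 0 := by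
  induction F using MvPolynomial.induction_on' with
  | monomial d a =>
    have hdvd : p ∣ (d i).ascFactorial p :=
      (Nat.dvd_factorial (Fact.out : p.Prime).pos le_rfl).trans (Nat.factorial_dvd_ascFactorial _ _)
    rw [sqEuler_iterate_monomial, (CharP.cast_eq_zero_iff K p _).2 hdvd, mul_zero,
      MvPolynomial.monomial_zero]
  | add F G hF hG => rw [iterate_map_add, hF, hG, add_zero]

theorem exists_sqEuler_iterate_ne_zero [NoZeroDivisors K] (p : ℕ) [Fact p.Prime] [CharP K p] (i : σ)
    {F : MvPolynomial σ K} (hF : F ≠ 0) :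
    ∃ j < p, (sqEuler i)^[j] F ≠ 0 ∧ MvPolynomial.pderiv i ((sqEuler i)^[j] F) = 0 := by
  classical
  have hex : ∃ j, (sqEuler i)^[j] F = 0 := ⟨p, sqEuler_iterate_prime p i F⟩
  obtain ⟨j, hj⟩ : ∃ j, Nat.find hex = j + 1 :=
    Nat.exists_eq_succ_of_ne_zero fun h => hF (by simpa [h] using Nat.find_spec hex)
  have hj_zero : X i ^ 2 * MvPolynomial.pderiv i ((sqEuler i)^[j] F) = 0 := by
    rw [← sqEuler_apply, ← Function.iterate_succ_apply' (sqEuler i), Nat.succ_eq_add_one, ← hj]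
    exact Nat.find_spec hex
  have : Nontrivial K := CharP.nontrivial_of_char_ne_one (Fact.out : p.Prime).ne_one
  exact ⟨j, hj.symm.trans_le (Nat.find_le (sqEuler_iterate_prime p i F)),
    Nat.find_min hex (by omega),
    (mul_eq_zero.1 hj_zero).resolve_left (pow_ne_zero _ (MvPolynomial.X_ne_zero _))⟩

theorem pderiv_sqEuler_iterate_of_ne {K : Type*} [CommRing K] {i i₀ : σ} (hi : i ≠ i₀)
    {F : MvPolynomial σ K} (hF : MvPolynomial.pderiv i F = 0) (j : ℕ) :
    MvPolynomial.pderiv i ((sqEuler i₀)^[j] F) = 0 := by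
  induction j with
  | zero => exact hF
  | succ j ih =>
    rw [Function.iterate_succ_apply', sqEuler_apply, MvPolynomial.pderiv_mul,
      MvPolynomial.pderiv_pow, pderiv_pderiv_comm, ih, MvPolynomial.pderiv_X_of_ne hi.symm]
    simp

theorem exists_sqEuler_iterate_eq_expand {K : Type*} [CommRing K] [NoZeroDivisors K] (p : ℕ)
    [Fact p.Prime] [CharP K p] (i₀ : σ) {F : MvPolynomial σ K} (hF : F ≠ 0)
    (hpderiv : ∀ i ≠ i₀, MvPolynomial.pderiv i F = 0) :
    ∃ j < p, ∃ G ≠ 0, (sqEuler i₀)^[j] F = MvPolynomial.expand p G := by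
  obtain ⟨j, hjp, hne, hzero⟩ := exists_sqEuler_iterate_ne_zero p i₀ hF
  have hall (i : σ) : MvPolynomial.pderiv i ((sqEuler i₀)^[j] F) = 0 := by
    rcases eq_or_ne i i₀ with rfl | h
    · exact hzero
    · exact pderiv_sqEuler_iterate_of_ne h (hpderiv i h) j
  obtain ⟨G, hG⟩ := exists_expand_eq_of_pderiv_eq_zero p hall
  exact ⟨j, hjp, G, fun h => hne (by rw [← hG, h, map_zero]), hG.symm⟩

theorem coeff_zero_sqEuler_iterate (i : σ) {F : MvPolynomial σ K} (hF : F.coeff 0 = 0) (j : ℕ) :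
    ((sqEuler i)^[j] F).coeff 0 = 0 := by
  cases j with
  | zero => exact hF
  | succ j =>
    rw [Function.iterate_succ_apply', sqEuler_apply, ← MvPolynomial.constantCoeff_eq]
    simp

end WeightedDegree

end PartialDerivatives

section Milnor

variable (p n : ℕ)

/-- The derivation `y_j ↦ y_j ^ p ^ i`, for `i ≥ 1` the restriction of the primitive
`[P^{p^{i-1}}, …, [P^p, P^1]]` of the Steenrod algebra. -/
def milnor (i : ℕ) : Derivation (ZMod p) (Poly p n) (Poly p n) :=
  MvPolynomial.mkDerivation _ fun j => X j ^ p ^ i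

/-- The derivation `milnor` acting on the coefficients of polynomials. -/
def milnorCoeffs (i : ℕ) : Derivation (ZMod p) (Poly p n)[X] (Poly p n)[X] :=
  PolynomialModule.equivPolynomialSelf.compDer (milnor p n i).mapCoeffs

variable {p n}

/-- Closed under all reduced powers. -/
def IsPowerClosed (N : Submodule (ZMod p) (Poly p n)) : Prop :=
  ∀ k, ∀ q ∈ N, polyPower p n k q ∈ N

theorem polyPower_apply (k : ℕ) (q : Poly p n) : polyPower p n k q = (totalPower p n q).coeff k :=
  rfl

theorem milnor_X (i : ℕ) (j : Fin n) : milnor p n i (X j) = X j ^ p ^ i :=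
  MvPolynomial.mkDerivation_X ..

theorem coeff_milnorCoeffs (i k : ℕ) (Q : (Poly p n)[X]) :
    (milnorCoeffs p n i Q).coeff k = milnor p n i (Q.coeff k) := rfl

theorem milnorCoeffs_C (i : ℕ) (q : Poly p n) :
    milnorCoeffs p n i (Polynomial.C q) = Polynomial.C (milnor p n i q) := by
  ext1 k
  rw [coeff_milnorCoeffs, Polynomial.coeff_C, Polynomial.coeff_C, apply_ite (milnor p n i),
    map_zero]

theorem milnorCoeffs_X (i : ℕ) : milnorCoeffs p n i Polynomial.X = 0 := by
  ext1 k
  rw [coeff_milnorCoeffs, Polynomial.coeff_X, apply_ite (milnor p n i), map_zero,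
    Derivation.map_one_eq_zero, ite_self, Polynomial.coeff_zero]

theorem totalPower_X (j : Fin n) : totalPower p n (X j) =
    Polynomial.C (X j) + Polynomial.C (X j ^ p) * Polynomial.X :=
  MvPolynomial.aeval_X ..

theorem totalPower_C (a : ZMod p) : totalPower p n (C a) = Polynomial.C (C a) :=
  (totalPower p n).commutes a

theorem coeff_zero_totalPower (q : Poly p n) : (totalPower p n q).coeff 0 = q := by
  induction q using MvPolynomial.induction_on with
  | C a => rw [totalPower_C, Polynomial.coeff_C_zero]
  | add q r hq hr => rw [map_add, Polynomial.coeff_add, hq, hr]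
  | mul_X q j hq => simp [totalPower_X, Polynomial.mul_coeff_zero, hq]

theorem coeff_one_totalPower (q : Poly p n) : (totalPower p n q).coeff 1 = milnor p n 1 q := by
  induction q using MvPolynomial.induction_on with
  | C a => rw [totalPower_C, MvPolynomial.derivation_C, Polynomial.coeff_C_of_ne_zero one_ne_zero]
  | add q r hq hr => rw [map_add, Polynomial.coeff_add, hq, hr, map_add]
  | mul_X q j hq =>
    rw [map_mul, totalPower_X, mul_add, ← mul_assoc, Polynomial.coeff_add, Polynomial.coeff_mul_C,
      hq, Polynomial.coeff_mul_X, Polynomial.coeff_mul_C, coeff_zero_totalPower,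
      Derivation.leibniz, milnor_X, smul_eq_mul, smul_eq_mul, pow_one]
    ring

variable [Fact p.Prime]

theorem milnor_pow_char (i : ℕ) (q : Poly p n) : milnor p n i (q ^ p) = 0 := by
  rw [Derivation.leibniz_pow, ← Nat.cast_smul_eq_nsmul (ZMod p), CharP.cast_eq_zero, zero_smul]

theorem totalPower_milnor (i : ℕ) (q : Poly p n) :
    totalPower p n (milnor p n i q) = milnorCoeffs p n i (totalPower p n q) +
      Polynomial.X ^ p ^ i * milnorCoeffs p n (i + 1) (totalPower p n q) := by
  induction q using MvPolynomial.induction_on with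
  | C a => simp [milnorCoeffs_C, MvPolynomial.derivation_C]
  | add q r hq hr =>
    simp only [map_add, hq, hr]
    ring
  | mul_X q j hq =>
    have hX (k : ℕ) : milnorCoeffs p n k (totalPower p n (X j)) =
        Polynomial.C (X j ^ p ^ k) := by
      rw [totalPower_X, map_add, Derivation.leibniz, milnorCoeffs_X, smul_zero, zero_add,
        milnorCoeffs_C, milnorCoeffs_C, milnor_pow_char, map_zero, smul_zero, add_zero, milnor_X]
    simp only [map_mul, map_add, Derivation.leibniz, smul_eq_mul, hX, milnor_X, totalPower_X_pow,
      hq]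
    ring

theorem IsPowerClosed.milnor_mem {N : Submodule (ZMod p) (Poly p n)} (hN : IsPowerClosed N) {i : ℕ}
    (hi : 1 ≤ i) : ∀ q ∈ N, milnor p n i q ∈ N := by
  induction i, hi using Nat.le_induction with
  | base => exact fun q hq => coeff_one_totalPower q ▸ hN 1 q hq
  | succ i _ ih =>
    intro q hq
    have hcomm : polyPower p n (p ^ i) (milnor p n i q) =
        milnor p n i (polyPower p n (p ^ i) q) + milnor p n (i + 1) q := by
      rw [polyPower_apply, totalPower_milnor, Polynomial.coeff_add, Polynomial.coeff_X_pow_mul',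
        if_pos le_rfl, Nat.sub_self, coeff_milnorCoeffs, coeff_milnorCoeffs, coeff_zero_totalPower,
        polyPower_apply]
    rw [← sub_eq_iff_eq_add'.2 hcomm]
    exact sub_mem (hN _ _ (ih q hq)) (ih _ (hN _ _ hq))

end Milnor

section DicksonEval

variable {p n : ℕ} [Fact p.Prime]

theorem IsPowerClosed.comap_expand {N : Submodule (ZMod p) (Poly p n)} (hN : IsPowerClosed N) :
    IsPowerClosed (N.comap (MvPolynomial.expand p).toLinearMap) := by
  intro k q hq
  have h : polyPower p n (p * k) (MvPolynomial.expand p q) =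
      MvPolynomial.expand p (polyPower p n k q) := by
    rw [MvPolynomial.expand_zmod, MvPolynomial.expand_zmod, polyPower_apply, map_pow,
      ← Polynomial.map_frobenius_expand, Polynomial.coeff_map,
      Polynomial.coeff_expand_mul' (Fact.out : p.Prime).pos, frobenius_def, polyPower_apply]
  exact Submodule.mem_comap.2 (h ▸ hN _ _ hq :)

variable (p n) in
/-- The polynomials in the variables `d_{n,i}`, up to sign, mapped to the invariants that these
variables stand for. -/
def dicksonEval : Poly p n →ₐ[ZMod p] Poly p n := MvPolynomial.aeval (dicksonCoeff p n)

theorem range_dicksonEval : (dicksonEval p n).range = dicksonAlgebra p n :=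
  (Algebra.adjoin_range_eq_range_aeval _ _).symm

theorem dicksonEval_X (s : Fin n) : dicksonEval p n (X s) = dicksonCoeff p n s :=
  MvPolynomial.aeval_X ..

theorem derivation_dicksonEval (d : Derivation (ZMod p) (Poly p n) (Poly p n)) (F : Poly p n) :
    d (dicksonEval p n F) =
      ∑ s, dicksonEval p n (MvPolynomial.pderiv s F) * d (dicksonCoeff p n s) :=
  derivation_aeval d _ F

variable [NeZero n]

theorem milnor_dicksonCoeff_vecMul_moore (i : ℕ) :
    Matrix.vecMul (milnor p n i ∘ dicksonCoeff p n) (moore p n) =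
      fun j => -(dicksonCoeff p n 0 * X j ^ p ^ i) := by
  ext1 j
  have hpow {k : ℕ} (hk : k ≠ 0) : milnor p n i (X j ^ p ^ k) = 0 := by
    obtain ⟨k, rfl⟩ := Nat.exists_eq_succ_of_ne_zero hk
    rw [pow_succ, pow_mul, milnor_pow_char]
  have h := congrArg (milnor p n i) (congrFun (dicksonCoeff_vecMul_moore (p := p)) j)
  rw [hpow (NeZero.ne n), vecMul_moore_apply, map_sum] at h
  simp only [Derivation.leibniz, smul_eq_mul, Finset.sum_add_distrib] at h
  rw [Finset.sum_eq_single 0 (fun s _ hs => by rw [hpow (Fin.val_ne_zero_iff.2 hs), mul_zero])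
    (by simp), Fin.val_zero, pow_zero, pow_one, milnor_X] at h
  simp only [vecMul_moore_apply, Function.comp_apply, mul_comm _ (X j ^ _)]
  rw [eq_neg_iff_add_eq_zero, add_comm, mul_comm, h]

theorem milnor_dicksonCoeff_of_lt (i s : Fin n) :
    milnor p n i (dicksonCoeff p n s) =
      (Pi.single i (-dicksonCoeff p n 0) : Fin n → Poly p n) s := by
  refine congrFun (vecMul_moore_inj.1
    ((milnor_dicksonCoeff_vecMul_moore (i : ℕ)).trans (funext fun j => ?_))) s
  rw [Matrix.single_vecMul, Pi.smul_apply, Matrix.row, moore_apply, smul_eq_mul, neg_mul]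

theorem milnor_dicksonCoeff_self (s : Fin n) :
    milnor p n n (dicksonCoeff p n s) = -(dicksonCoeff p n 0 * dicksonCoeff p n s) := by
  have h : milnor p n n ∘ dicksonCoeff p n = -dicksonCoeff p n 0 • dicksonCoeff p n := by
    refine vecMul_moore_inj.1 ((milnor_dicksonCoeff_vecMul_moore n).trans ?_)
    rw [Matrix.smul_vecMul, dicksonCoeff_vecMul_moore]
    exact funext fun j => (neg_mul _ _).symm
  exact (congrFun h s).trans (neg_mul _ _)

theorem milnor_dicksonEval_of_lt (i : Fin n) (F : Poly p n) :
    milnor p n i (dicksonEval p n F) = -dicksonEval p n (X 0 * MvPolynomial.pderiv i F) := by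
  simp only [derivation_dicksonEval, milnor_dicksonCoeff_of_lt]
  rw [Fintype.sum_eq_single i fun s hs => by rw [Pi.single_eq_of_ne hs, mul_zero],
    Pi.single_eq_same, mul_neg, mul_comm, map_mul, dicksonEval_X]

theorem milnor_dicksonEval_self (F : Poly p n) :
    milnor p n n (dicksonEval p n F) =
      -dicksonEval p n (X 0 * ∑ s, X s * MvPolynomial.pderiv s F) := by
  simp only [derivation_dicksonEval, milnor_dicksonCoeff_self, map_mul, map_sum, dicksonEval_X,
    Finset.mul_sum, mul_neg, Finset.sum_neg_distrib]
  exact congrArg _ (Finset.sum_congr rfl fun s _ => by ring)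

end DicksonEval

section Reduction

variable {p n : ℕ} [Fact p.Prime] [NeZero n] {N : Submodule (ZMod p) (Poly p n)}

theorem IsPowerClosed.dicksonEval_X_mul_pderiv_mem (hN : IsPowerClosed N) {F : Poly p n}
    (hF : dicksonEval p n F ∈ N) {i : Fin n} (hi : i ≠ 0) :
    dicksonEval p n (X 0 * MvPolynomial.pderiv i F) ∈ N := by
  have h := hN.milnor_mem (Nat.one_le_iff_ne_zero.2 (Fin.val_ne_zero_iff.2 hi)) _ hF
  rwa [milnor_dicksonEval_of_lt, neg_mem_iff] at h

theorem IsPowerClosed.dicksonEval_sqEuler_iterate_mem (hN : IsPowerClosed N) {F : Poly p n}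
    (hpderiv : ∀ i ≠ 0, MvPolynomial.pderiv i F = 0) (hF : dicksonEval p n F ∈ N) (j : ℕ) :
    dicksonEval p n ((sqEuler 0)^[j] F) ∈ N := by
  induction j with
  | zero => exact hF
  | succ j ih =>
    have h := hN.milnor_mem (NeZero.one_le (n := n)) _ ih
    rw [milnor_dicksonEval_self, neg_mem_iff, Fintype.sum_eq_single 0 fun s hs => by
      rw [pderiv_sqEuler_iterate_of_ne hs (hpderiv s hs), mul_zero], ← mul_assoc, ← pow_two] at h
    rwa [Function.iterate_succ_apply']

variable (n) in
/-- The weight `1` on the first variable and `2` on the others: it is lowered by `X_0 ∂/∂X_i` for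
`i ≠ 0` and raised by just one by `X_0 ^ 2 ∂/∂X_0`. -/
def dicksonWeight (s : Fin n) : ℕ := if s = 0 then 1 else 2

theorem dicksonWeight_zero : dicksonWeight n 0 = 1 := if_pos rfl

theorem dicksonWeight_of_ne_zero {i : Fin n} (hi : i ≠ 0) : dicksonWeight n i = 2 := if_neg hi

theorem eq_C_mul_X_of_weightedTotalDegree_le_one {K : Type*} [CommSemiring K]
    {F : MvPolynomial (Fin n) K}
    (hle : F.weightedTotalDegree (dicksonWeight n) ≤ 1) (h0 : F.coeff 0 = 0) :
    F = C (F.coeff (Finsupp.single 0 1)) * X 0 := by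
  ext d
  rw [MvPolynomial.coeff_C_mul, MvPolynomial.coeff_X]
  split_ifs with hd
  · rw [← hd, mul_one]
  · rw [mul_zero]
    by_contra hF
    have hweight := (MvPolynomial.le_weightedTotalDegree (dicksonWeight n)
      (MvPolynomial.mem_support_iff.2 hF)).trans hle
    rw [Finsupp.weight_apply, Finsupp.sum_fintype _ _ (by simp)] at hweight
    have hle (s : Fin n) : d s * dicksonWeight n s ≤ 1 :=
      (Finset.single_le_sum (f := fun s => d s * dicksonWeight n s) (fun _ _ => Nat.zero_le _)
        (Finset.mem_univ s)).trans hweight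
    have hd_eq : d = Finsupp.single 0 (d 0) := by
      ext s
      rcases eq_or_ne s 0 with rfl | hs
      · simp
      · have := hle s
        rw [dicksonWeight_of_ne_zero hs] at this
        rw [Finsupp.single_eq_of_ne hs]
        omega
    have hd0 : d 0 ≤ 1 := by simpa [dicksonWeight_zero] using hle 0
    interval_cases d 0
    · exact hF (by rw [hd_eq, Finsupp.single_zero, h0])
    · exact hd hd_eq.symm

theorem weightedTotalDegree_lt_of_sqEuler_iterate_eq_expand {F G : Poly p n} {j : ℕ} (hj : j < p)
    (hG : (sqEuler 0)^[j] F = MvPolynomial.expand p G)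
    (hF : 1 < F.weightedTotalDegree (dicksonWeight n)) :
    G.weightedTotalDegree (dicksonWeight n) < F.weightedTotalDegree (dicksonWeight n) := by
  have hle := weightedTotalDegree_sqEuler_iterate_le (dicksonWeight n) 0 F j
  rw [hG, weightedTotalDegree_expand _ (Fact.out : p.Prime).ne_zero, dicksonWeight_zero] at hle
  have := (Fact.out : p.Prime).two_le
  by_contra! hcon
  nlinarith

theorem IsPowerClosed.exists_dicksonCoeff_pow_mem (hN : IsPowerClosed N) {F : Poly p n}
    (hF : F ≠ 0) (h0 : F.coeff 0 = 0) (hFN : dicksonEval p n F ∈ N) :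
    ∃ k, dicksonCoeff p n 0 ^ p ^ k ∈ N := by
  induction hm : F.weightedTotalDegree (dicksonWeight n) using Nat.strong_induction_on
    generalizing F N with
  | _ m ih =>
  subst hm
  by_cases hpderiv : ∀ i ≠ 0, MvPolynomial.pderiv i F = 0
  · rcases le_or_gt (F.weightedTotalDegree (dicksonWeight n)) 1 with hle | hgt
    · have hlin := eq_C_mul_X_of_weightedTotalDegree_le_one hle h0
      have ha : F.coeff (Finsupp.single 0 1) ≠ 0 := fun ha =>
        hF (by rw [hlin, ha, map_zero, zero_mul])
      rw [hlin, ← MvPolynomial.smul_eq_C_mul, map_smul, dicksonEval_X, N.smul_mem_iff ha] at hFN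
      exact ⟨0, by rwa [pow_zero, pow_one]⟩
    · obtain ⟨j, hj, G, hG0, hG⟩ := exists_sqEuler_iterate_eq_expand p 0 hF hpderiv
      have hcoeff : G.coeff 0 = 0 := by
        rw [← MvPolynomial.coeff_expand_zero p (Fact.out : p.Prime).ne_zero, ← hG]
        exact coeff_zero_sqEuler_iterate 0 h0 j
      have hmem := hN.dicksonEval_sqEuler_iterate_mem hpderiv hFN j
      rw [hG, MvPolynomial.expand_zmod, map_pow, ← MvPolynomial.expand_zmod,
        ← AlgHom.toLinearMap_apply, ← Submodule.mem_comap] at hmem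
      obtain ⟨k, hk⟩ := ih _ (weightedTotalDegree_lt_of_sqEuler_iterate_eq_expand hj hG hgt)
        hN.comap_expand hG0 hcoeff hmem rfl
      rw [Submodule.mem_comap, AlgHom.toLinearMap_apply, MvPolynomial.expand_zmod, ← pow_mul,
        ← pow_succ] at hk
      exact ⟨k + 1, hk⟩
  · push Not at hpderiv
    obtain ⟨i, hi, hne⟩ := hpderiv
    have hX := weightedTotalDegree_X_mul_le (dicksonWeight n) 0 (MvPolynomial.pderiv i F)
    have hderiv := weightedTotalDegree_pderiv_add_le (dicksonWeight n) hne
    rw [dicksonWeight_zero] at hX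
    rw [dicksonWeight_of_ne_zero hi] at hderiv
    refine ih _ (by omega) hN (mul_ne_zero (MvPolynomial.X_ne_zero 0) hne) ?_
      (hN.dicksonEval_X_mul_pderiv_mem hFN hi) rfl
    rw [← MvPolynomial.constantCoeff_eq, map_mul, MvPolynomial.constantCoeff_X, zero_mul]

theorem IsPowerClosed.dicksonCoeff_zero_pow_prime_mem (hN : IsPowerClosed N)
    (h : dicksonCoeff p n 0 ∈ N) : dicksonCoeff p n 0 ^ p ∈ N := by
  have hp := (Fact.out : p.Prime)
  have hmem := hN.dicksonEval_sqEuler_iterate_mem (F := X 0)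
    (fun i hi => MvPolynomial.pderiv_X_of_ne hi.symm) (by rwa [dicksonEval_X]) (p - 1)
  rw [X, sqEuler_iterate_monomial, Finsupp.single_eq_same, Nat.one_ascFactorial, one_mul,
    ← Finsupp.single_add, Nat.add_sub_cancel' hp.one_le,
    ← mul_one ((Nat.factorial _ : ℕ) : ZMod p), ← smul_eq_mul, ← MvPolynomial.smul_monomial,
    ← MvPolynomial.X_pow_eq_monomial] at hmem
  rwa [map_smul, map_pow, dicksonEval_X, N.smul_mem_iff] at hmem
  rw [Ne, ZMod.natCast_eq_zero_iff, hp.dvd_factorial]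
  exact not_le.2 (Nat.sub_one_lt hp.ne_zero)

theorem IsPowerClosed.dicksonCoeff_zero_pow_succ_mem (hN : IsPowerClosed N) {k : ℕ}
    (h : dicksonCoeff p n 0 ^ p ^ k ∈ N) : dicksonCoeff p n 0 ^ p ^ (k + 1) ∈ N := by
  induction k generalizing N with
  | zero =>
    rw [zero_add, pow_one]
    exact hN.dicksonCoeff_zero_pow_prime_mem (by rwa [pow_zero, pow_one] at h)
  | succ k ih =>
    rw [pow_succ, pow_mul, ← MvPolynomial.expand_zmod, ← AlgHom.toLinearMap_apply,
      ← Submodule.mem_comap] at h ⊢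
    exact ih hN.comap_expand h

theorem IsPowerClosed.dicksonCoeff_zero_pow_mem_of_le (hN : IsPowerClosed N) {j k : ℕ} (hjk : j ≤ k)
    (h : dicksonCoeff p n 0 ^ p ^ j ∈ N) : dicksonCoeff p n 0 ^ p ^ k ∈ N :=
  Nat.le_induction h (fun _ _ => hN.dicksonCoeff_zero_pow_succ_mem) k hjk

end Reduction

section Contraction

variable {R V : Type*} [CommRing R] [AddCommGroup V] [Module R V]

theorem contractLeft_mul {Q : QuadraticForm R V} (d : Module.Dual R V) (a b : CliffordAlgebra Q) :
    CliffordAlgebra.contractLeft d (a * b) = CliffordAlgebra.contractLeft d a * b +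
      CliffordAlgebra.involute a * CliffordAlgebra.contractLeft d b := by
  induction a using CliffordAlgebra.left_induction with
  | algebraMap r =>
    rw [CliffordAlgebra.contractLeft_algebraMap_mul, CliffordAlgebra.contractLeft_algebraMap,
      AlgHom.commutes, zero_mul, zero_add]
  | add a a' h h' =>
    rw [add_mul, map_add, h, h', map_add, map_add, add_mul, add_mul]
    abel
  | ι_mul a m h =>
    rw [mul_assoc, CliffordAlgebra.contractLeft_ι_mul, h, CliffordAlgebra.contractLeft_ι_mul,
      map_mul, CliffordAlgebra.involute_ι]
    simp only [smul_mul_assoc, sub_mul, mul_add, neg_mul, mul_assoc]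
    abel

theorem exteriorMap_id_sub_smulRight (d : Module.Dual R V) (e : V) (a : ExteriorAlgebra R V) :
    ExteriorAlgebra.map (LinearMap.id - d.smulRight e) a =
      a - ExteriorAlgebra.ι R e * CliffordAlgebra.contractLeft d a := by
  induction a using CliffordAlgebra.left_induction with
  | algebraMap r => simp
  | add a b ha hb =>
    rw [map_add, ha, hb, map_add, mul_add]
    abel
  | ι_mul a m h =>
    have hswap : ExteriorAlgebra.ι R m * ExteriorAlgebra.ι R e =
        -(ExteriorAlgebra.ι R e * ExteriorAlgebra.ι R m) :=
      eq_neg_of_add_eq_zero_left (ExteriorAlgebra.ι_add_mul_swap m e)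
    have hmap : ExteriorAlgebra.map (LinearMap.id - d.smulRight e) (ExteriorAlgebra.ι R m) =
        ExteriorAlgebra.ι R m - d m • ExteriorAlgebra.ι R e := by
      rw [ExteriorAlgebra.map_apply_ι, LinearMap.sub_apply, LinearMap.id_apply,
        LinearMap.smulRight_apply, map_sub, map_smul]
    rw [CliffordAlgebra.contractLeft_ι_mul, map_mul, h]
    refine (congrArg (· * _) hmap).trans ?_
    simp only [sub_mul, mul_sub, smul_mul_assoc, mul_smul_comm, ← mul_assoc, hswap,
      ExteriorAlgebra.ι_sq_zero, zero_mul, smul_zero]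
    simp only [neg_mul]
    abel_nf

end Contraction

section Coh

variable {p n : ℕ}

instance : Algebra (Poly p n) (Coh p n) := Algebra.TensorProduct.rightAlgebra

-- Shortcuts: the search for these instances otherwise times out.
instance : Module (Poly p n) (Coh p n) := Algebra.toModule

instance : DistribMulAction (Poly p n) (Coh p n) := Module.toDistribMulAction

instance : MulAction (Poly p n) (Coh p n) := DistribMulAction.toMulAction

instance : SMul (Poly p n) (Coh p n) := Algebra.toSMul

instance : IsScalarTower (Poly p n) (Coh p n) (Coh p n) := IsScalarTower.right

instance : SMulCommClass (Poly p n) (Coh p n) (Coh p n) := Algebra.to_smulCommClass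

instance : SMulCommClass (Poly p n) ℤ (Coh p n) :=
  AddGroup.int_smulCommClass' (M := Poly p n) (A := Coh p n)

instance : IsScalarTower ℤ (Poly p n) (Coh p n) :=
  AddCommGroup.intIsScalarTower (R := Poly p n) (M := Coh p n)

instance : IsScalarTower (ZMod p) (Poly p n) (Coh p n) :=
  Algebra.TensorProduct.right_isScalarTower

theorem incl_mul (q : Poly p n) (z : Coh p n) : incl p n q * z = q • z :=
  (Algebra.smul_def q z).symm

theorem mul_incl (q : Poly p n) (z : Coh p n) : z * incl p n q = q • z :=
  (Algebra.commutes q z).symm.trans (incl_mul q z)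

theorem incl_eq_smul_one (q : Poly p n) : incl p n q = q • 1 := by
  rw [← incl_mul, mul_one]

theorem smul_tmul (q b : Poly p n) (a : ExteriorAlgebra (ZMod p) (Fin n → ZMod p)) :
    q • (a ⊗ₜ[ZMod p] b : Coh p n) = a ⊗ₜ (q * b) := by
  rw [← incl_mul, incl, Algebra.TensorProduct.includeRight_apply,
    Algebra.TensorProduct.tmul_mul_tmul, one_mul]

theorem smul_eq_lTensor (q : Poly p n) (z : Coh p n) :
    q • z = LinearMap.lTensor _ (LinearMap.mulLeft (ZMod p) q) z := by
  induction z using TensorProduct.induction_on with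
  | zero => simp
  | tmul a b => rw [smul_tmul, LinearMap.lTensor_tmul, LinearMap.mulLeft_apply]
  | add z w hz hw => rw [smul_add, hz, hw, map_add]

variable (p n) in
/-- The projection which kills the exterior generators. -/
def exteriorAug : Coh p n →ₐ[ZMod p] Poly p n :=
  Algebra.TensorProduct.lift
    ((Algebra.ofId (ZMod p) _).comp ExteriorAlgebra.algebraMapInv) (AlgHom.id _ _)
    fun _ _ => Commute.all _ _

variable (p n) in
/-- The grade involution with respect to the exterior degree. -/
def gradeInvol : Coh p n →ₐ[ZMod p] Coh p n :=
  Algebra.TensorProduct.map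
    (CliffordAlgebra.involute (Q := (0 : QuadraticForm (ZMod p) (Fin n → ZMod p))))
    (AlgHom.id _ _)

variable (p n) in
/-- The contraction `∂/∂x_j`. -/
def contr (j : Fin n) : Coh p n →ₗ[Poly p n] Coh p n where
  __ := LinearMap.rTensor (Poly p n) (CliffordAlgebra.contractLeft
    (Q := (0 : QuadraticForm (ZMod p) (Fin n → ZMod p))) (LinearMap.proj j))
  map_smul' q z := by
    change LinearMap.rTensor _ _ _ = q • LinearMap.rTensor _ _ z
    rw [smul_eq_lTensor, smul_eq_lTensor, ← LinearMap.comp_apply, LinearMap.rTensor_comp_lTensor,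
      ← LinearMap.lTensor_comp_rTensor, LinearMap.comp_apply]

variable (p n) in
/-- The derivation `x_j ↦ y_j ^ p ^ i`, by which Milnor's `Q_i` acts: `Q_0 = β` and
`Q_{i+1} = [P^{p^i}, Q_i]`. -/
def milnorQ (i : ℕ) : Coh p n →ₗ[Poly p n] Coh p n := ∑ j, (X j ^ p ^ i : Poly p n) • contr p n j

theorem exteriorAug_tmul (a : ExteriorAlgebra (ZMod p) (Fin n → ZMod p)) (b : Poly p n) :
    exteriorAug p n (a ⊗ₜ b) = C (ExteriorAlgebra.algebraMapInv a) * b := by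
  simp [exteriorAug, Algebra.ofId_apply, MvPolynomial.algebraMap_eq]

theorem exteriorAug_incl (q : Poly p n) : exteriorAug p n (incl p n q) = q := by
  simp [exteriorAug, incl]

theorem incl_injective : Function.Injective (incl p n) :=
  Function.LeftInverse.injective exteriorAug_incl

theorem exteriorAug_x (j : Fin n) : exteriorAug p n (x p n j) = 0 := by
  simp [x, exteriorAug_tmul, ExteriorAlgebra.algebraMapInv]

theorem exteriorAug_smul (q : Poly p n) (z : Coh p n) :
    exteriorAug p n (q • z) = q * exteriorAug p n z := by
  rw [← incl_mul, map_mul, exteriorAug_incl]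

theorem gradeInvol_incl (q : Poly p n) : gradeInvol p n (incl p n q) = incl p n q := by
  simp [gradeInvol, incl]

theorem gradeInvol_x (j : Fin n) : gradeInvol p n (x p n j) = -x p n j := by
  rw [x, gradeInvol, Algebra.TensorProduct.map_tmul, ← TensorProduct.neg_tmul, map_one]
  exact congrArg (· ⊗ₜ 1) (CliffordAlgebra.involute_ι _)

theorem gradeInvol_smul (q : Poly p n) (z : Coh p n) :
    gradeInvol p n (q • z) = q • gradeInvol p n z := by
  rw [← incl_mul, map_mul, gradeInvol_incl, incl_mul]

theorem x_mul_x (i j : Fin n) : x p n i * x p n j = -(x p n j * x p n i) := by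
  rw [eq_neg_iff_add_eq_zero]
  simp only [x, Algebra.TensorProduct.tmul_mul_tmul, ← TensorProduct.add_tmul, mul_one,
    ExteriorAlgebra.ι_add_mul_swap, TensorProduct.zero_tmul]

theorem contr_tmul (j : Fin n) (a : ExteriorAlgebra (ZMod p) (Fin n → ZMod p)) (b : Poly p n) :
    contr p n j (a ⊗ₜ b) = CliffordAlgebra.contractLeft
      (Q := (0 : QuadraticForm (ZMod p) (Fin n → ZMod p))) (LinearMap.proj j) a ⊗ₜ b := rfl

theorem contr_mul (j : Fin n) (u v : Coh p n) :
    contr p n j (u * v) = contr p n j u * v + gradeInvol p n u * contr p n j v := by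
  induction u using TensorProduct.induction_on with
  | zero => simp
  | add u u' h h' => rw [add_mul, map_add, h, h', map_add, map_add, add_mul, add_mul]; abel
  | tmul a b =>
    induction v using TensorProduct.induction_on with
    | zero => simp
    | add v v' h h' => rw [mul_add, map_add, h, h', map_add, mul_add, mul_add]; abel
    | tmul c d =>
      rw [Algebra.TensorProduct.tmul_mul_tmul, contr_tmul, contr_tmul, contr_tmul, gradeInvol,
        Algebra.TensorProduct.map_tmul, Algebra.TensorProduct.tmul_mul_tmul,
        Algebra.TensorProduct.tmul_mul_tmul, AlgHom.id_apply, ← TensorProduct.add_tmul]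
      exact congrArg (· ⊗ₜ (b * d)) (contractLeft_mul _ a c)

theorem contr_one (j : Fin n) : contr p n j 1 = 0 := by
  have h := CliffordAlgebra.contractLeft_one (0 : QuadraticForm (ZMod p) (Fin n → ZMod p))
    (LinearMap.proj j)
  rw [Algebra.TensorProduct.one_def, contr_tmul, h, TensorProduct.zero_tmul]

theorem contr_x (j k : Fin n) : contr p n j (x p n k) = if k = j then 1 else 0 := by
  have h := CliffordAlgebra.contractLeft_ι (0 : QuadraticForm (ZMod p) (Fin n → ZMod p))
    (LinearMap.proj j) (Pi.single k 1)
  rw [x, contr_tmul, ExteriorAlgebra.ι, h, LinearMap.proj_apply, Pi.single_apply]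
  simp only [eq_comm (a := j)]
  split_ifs <;> simp [Algebra.TensorProduct.one_def]

theorem contr_contr (j k : Fin n) (z : Coh p n) :
    contr p n j (contr p n k z) = -contr p n k (contr p n j z) := by
  induction z using TensorProduct.induction_on with
  | zero => simp
  | tmul a b =>
    simp only [contr_tmul]
    rw [CliffordAlgebra.contractLeft_comm, TensorProduct.neg_tmul]
  | add z w hz hw => rw [map_add, map_add, hz, hw, map_add, map_add, neg_add]

theorem milnorQ_apply (i : ℕ) (z : Coh p n) :
    milnorQ p n i z = ∑ j, (X j ^ p ^ i : Poly p n) • contr p n j z := by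
  rw [milnorQ, LinearMap.sum_apply]
  rfl

theorem milnorQ_zero (z : Coh p n) : milnorQ p n 0 z = bockstein p n z := by
  rw [milnorQ_apply, bockstein, LinearMap.sum_apply]
  refine Finset.sum_congr rfl fun j _ => ?_
  rw [pow_zero, pow_one]
  induction z using TensorProduct.induction_on with
  | zero => simp
  | tmul a b => rw [contr_tmul, smul_tmul, TensorProduct.map_tmul, LinearMap.mulLeft_apply]
  | add z w hz hw => rw [map_add, smul_add, hz, hw, map_add]

theorem milnorQ_milnorQ (i k : ℕ) (z : Coh p n) :
    milnorQ p n i (milnorQ p n k z) = -milnorQ p n k (milnorQ p n i z) := by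
  simp only [milnorQ_apply, map_sum, map_smul, Finset.smul_sum, ← Finset.sum_neg_distrib]
  rw [Finset.sum_comm]
  refine Finset.sum_congr rfl fun a _ => Finset.sum_congr rfl fun b _ => ?_
  rw [contr_contr, smul_neg, smul_neg, smul_comm]

theorem bockstein_mul (u v : Coh p n) :
    bockstein p n (u * v) = bockstein p n u * v + gradeInvol p n u * bockstein p n v := by
  simp only [← milnorQ_zero, milnorQ_apply, contr_mul, smul_add, Finset.sum_add_distrib,
    Finset.sum_mul, Finset.mul_sum, smul_mul_assoc, mul_smul_comm]

theorem bockstein_smul (q : Poly p n) (z : Coh p n) :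
    bockstein p n (q • z) = q • bockstein p n z := by
  rw [← milnorQ_zero, map_smul, milnorQ_zero]

theorem bockstein_incl (q : Poly p n) : bockstein p n (incl p n q) = 0 := by
  simp [← milnorQ_zero, milnorQ_apply, incl_eq_smul_one, contr_one]

theorem bockstein_x (j : Fin n) : bockstein p n (x p n j) = incl p n (X j) := by
  simp [← milnorQ_zero, milnorQ_apply, contr_x, incl_eq_smul_one]

theorem commute_C_includeLeft_map_incl (a : ExteriorAlgebra (ZMod p) (Fin n → ZMod p))
    (q : Poly p n) :
    Commute ((Polynomial.CAlgHom (R := ZMod p)).comp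
        (Algebra.TensorProduct.includeLeft : _ →ₐ[ZMod p] Coh p n) a)
      ((Polynomial.mapAlgHom (incl p n)).comp (totalPower p n) q) := by
  ext k
  simp [incl, Polynomial.coeff_C_mul, Polynomial.coeff_mul_C]

variable (p n) in
/-- The total reduced power `∑ P^k T^k`. -/
def cohPower : Coh p n →ₐ[ZMod p] (Coh p n)[X] :=
  Algebra.TensorProduct.lift
    (Polynomial.CAlgHom.comp Algebra.TensorProduct.includeLeft)
    ((Polynomial.mapAlgHom (incl p n)).comp (totalPower p n))
    commute_C_includeLeft_map_incl

theorem power_tmul (k : ℕ) (a : ExteriorAlgebra (ZMod p) (Fin n → ZMod p)) (b : Poly p n) :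
    power p n k (a ⊗ₜ b) = a ⊗ₜ polyPower p n k b := rfl

theorem power_incl (k : ℕ) (q : Poly p n) :
    power p n k (incl p n q) = incl p n (polyPower p n k q) := rfl

theorem power_contr (k : ℕ) (j : Fin n) (z : Coh p n) :
    power p n k (contr p n j z) = contr p n j (power p n k z) := by
  induction z using TensorProduct.induction_on with
  | zero => simp
  | tmul a b => rfl
  | add z w hz hw => simp only [map_add, hz, hw]

theorem cohPower_tmul (a : ExteriorAlgebra (ZMod p) (Fin n → ZMod p)) (b : Poly p n) :
    cohPower p n (a ⊗ₜ b) =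
      Polynomial.C (a ⊗ₜ 1) * (totalPower p n b).map (incl p n).toRingHom := by
  rw [cohPower, Algebra.TensorProduct.lift_tmul]
  rfl

theorem coeff_cohPower (k : ℕ) (z : Coh p n) : (cohPower p n z).coeff k = power p n k z := by
  induction z using TensorProduct.induction_on with
  | zero => simp
  | tmul a b =>
    rw [cohPower_tmul, Polynomial.coeff_C_mul, Polynomial.coeff_map, power_tmul]
    exact (Algebra.TensorProduct.tmul_mul_tmul ..).trans
      (congrArg₂ (· ⊗ₜ ·) (mul_one a) (one_mul _))
  | add z w hz hw => simp only [map_add, Polynomial.coeff_add, hz, hw]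

theorem cohPower_incl (q : Poly p n) :
    cohPower p n (incl p n q) = (totalPower p n q).map (incl p n).toRingHom := by
  rw [incl, Algebra.TensorProduct.includeRight_apply, cohPower_tmul,
    ← Algebra.TensorProduct.one_def, Polynomial.C_1, one_mul]
  rfl

theorem cohPower_x (j : Fin n) : cohPower p n (x p n j) = Polynomial.C (x p n j) := by
  rw [x, cohPower_tmul, map_one, Polynomial.map_one, mul_one]

theorem power_zero (z : Coh p n) : power p n 0 z = z := by
  induction z using TensorProduct.induction_on with
  | zero => simp
  | tmul a b => rw [power_tmul, polyPower_apply, coeff_zero_totalPower]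
  | add z w hz hw => rw [map_add, hz, hw]

variable [Fact p.Prime]

theorem milnorQ_succ (i : ℕ) (z : Coh p n) :
    milnorQ p n (i + 1) z =
      power p n (p ^ i) (milnorQ p n i z) - milnorQ p n i (power p n (p ^ i) z) := by
  have hsmul (j : Fin n) (w : Coh p n) : power p n (p ^ i) ((X j ^ p ^ i : Poly p n) • w) =
      (X j ^ p ^ i : Poly p n) • power p n (p ^ i) w + (X j ^ p ^ (i + 1) : Poly p n) • w := by
    have hmap (q : Poly p n) : (Polynomial.C q).map (incl p n).toRingHom =
        Polynomial.C (incl p n q) := Polynomial.map_C _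
    rw [← coeff_cohPower, ← incl_mul, map_mul, cohPower_incl, totalPower_X_pow,
      Polynomial.map_add, Polynomial.map_mul, Polynomial.map_pow, Polynomial.map_X, hmap, hmap,
      add_mul, mul_assoc, Polynomial.coeff_add, Polynomial.coeff_C_mul, Polynomial.coeff_X_pow_mul',
      if_pos le_rfl, Nat.sub_self, Polynomial.coeff_C_mul, coeff_cohPower, coeff_cohPower,
      power_zero, incl_mul, incl_mul]
  simp only [milnorQ_apply, map_sum, hsmul, power_contr, Finset.sum_add_distrib,
    add_sub_cancel_left]

instance : Module.IsTorsionFree (Poly p n) (Coh p n) where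
  isSMulRegular q hq := by
    have := Module.Flat.lTensor_preserves_injective_linearMap
      (M := ExteriorAlgebra (ZMod p) (Fin n → ZMod p)) (LinearMap.mulLeft (ZMod p) q)
      (mul_right_injective₀ hq.ne_zero)
    intro z w h
    simp only [smul_eq_lTensor] at h
    exact this h

end Coh

section KernelOfContractions

variable {p n : ℕ}

variable (p) in
/-- The linear map which sets the coordinates in `s` to zero. -/
def killCoords (s : Finset (Fin n)) : (Fin n → ZMod p) →ₗ[ZMod p] (Fin n → ZMod p) :=
  LinearMap.pi fun i => if i ∈ s then 0 else LinearMap.proj i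

theorem killCoords_empty : killCoords p (∅ : Finset (Fin n)) = LinearMap.id := by
  ext
  simp [killCoords]

theorem killCoords_univ : killCoords p (Finset.univ : Finset (Fin n)) = 0 := by
  ext
  simp [killCoords]

theorem killCoords_insert (j : Fin n) (s : Finset (Fin n)) :
    killCoords p (insert j s) =
      (LinearMap.id - (LinearMap.proj j).smulRight (Pi.single j 1)) ∘ₗ killCoords p s := by
  ext k i
  by_cases hj : i = j <;> by_cases hs : i ∈ s <;> simp [killCoords, hj, hs]

variable (p n) in
/-- The endomorphism of `E(x_1, …, x_n) ⊗ P[y_1, …, y_n]` induced by a linear map on the exterior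
generators. -/
def exteriorSubst (g : (Fin n → ZMod p) →ₗ[ZMod p] (Fin n → ZMod p)) : Coh p n →ₐ[ZMod p] Coh p n :=
  Algebra.TensorProduct.map (ExteriorAlgebra.map g) (AlgHom.id _ _)

theorem exteriorSubst_tmul (g : (Fin n → ZMod p) →ₗ[ZMod p] (Fin n → ZMod p))
    (a : ExteriorAlgebra (ZMod p) (Fin n → ZMod p)) (b : Poly p n) :
    exteriorSubst p n g (a ⊗ₜ b) = ExteriorAlgebra.map g a ⊗ₜ b :=
  Algebra.TensorProduct.map_tmul ..

theorem exteriorSubst_id (z : Coh p n) : exteriorSubst p n LinearMap.id z = z := by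
  rw [exteriorSubst, ExteriorAlgebra.map_id, Algebra.TensorProduct.map_id, AlgHom.id_apply]

theorem exteriorSubst_comp (g h : (Fin n → ZMod p) →ₗ[ZMod p] (Fin n → ZMod p)) (z : Coh p n) :
    exteriorSubst p n (g ∘ₗ h) z = exteriorSubst p n g (exteriorSubst p n h z) := by
  induction z using TensorProduct.induction_on with
  | zero => simp
  | tmul a b =>
    rw [exteriorSubst_tmul, exteriorSubst_tmul, exteriorSubst_tmul, ← ExteriorAlgebra.map_comp_map,
      AlgHom.comp_apply]
  | add z w hz hw => simp only [map_add, hz, hw]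

theorem exteriorSubst_zero (z : Coh p n) :
    exteriorSubst p n 0 z = incl p n (exteriorAug p n z) := by
  have hmap : ExteriorAlgebra.map (0 : (Fin n → ZMod p) →ₗ[ZMod p] (Fin n → ZMod p)) =
      (Algebra.ofId _ _).comp ExteriorAlgebra.algebraMapInv := by
    ext
    simp [ExteriorAlgebra.algebraMapInv]
  induction z using TensorProduct.induction_on with
  | zero => simp
  | tmul a b =>
    rw [exteriorSubst_tmul, hmap, exteriorAug_tmul, incl,
      Algebra.TensorProduct.includeRight_apply, AlgHom.comp_apply, Algebra.ofId_apply,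
      Algebra.algebraMap_eq_smul_one, TensorProduct.smul_tmul, MvPolynomial.smul_eq_C_mul]
  | add z w hz hw => simp only [map_add, hz, hw]

theorem exteriorSubst_id_sub_smulRight (j : Fin n) (z : Coh p n) :
    exteriorSubst p n (LinearMap.id - (LinearMap.proj j).smulRight (Pi.single j 1)) z =
      z - x p n j * contr p n j z := by
  induction z using TensorProduct.induction_on with
  | zero => simp
  | tmul a b =>
    rw [exteriorSubst_tmul, exteriorMap_id_sub_smulRight, contr_tmul, x,
      Algebra.TensorProduct.tmul_mul_tmul, one_mul, TensorProduct.sub_tmul]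
  | add z w hz hw =>
    rw [map_add, hz, hw, map_add, mul_add]
    abel

theorem eq_incl_of_contr_eq_zero {z : Coh p n} (h : ∀ j, contr p n j z = 0) :
    z = incl p n (exteriorAug p n z) := by
  have hkill (s : Finset (Fin n)) : exteriorSubst p n (killCoords p s) z = z := by
    induction s using Finset.induction_on with
    | empty => rw [killCoords_empty, exteriorSubst_id]
    | insert j s _ ih =>
      rw [killCoords_insert, exteriorSubst_comp, ih, exteriorSubst_id_sub_smulRight, h, mul_zero,
        sub_zero]
  rw [← exteriorSubst_zero, ← killCoords_univ, hkill]

open scoped Matrix.Module in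
theorem contr_eq_zero_of_milnorQ_eq_zero [Fact p.Prime] {z : Coh p n}
    (h : ∀ i < n, milnorQ p n i z = 0) (j : Fin n) : contr p n j z = 0 := by
  have hmoore : moore p n • (fun k => contr p n k z) = 0 := by
    ext1 i
    rw [Matrix.Module.smul_apply, Pi.zero_apply, ← h i i.2, milnorQ_apply]
    rfl
  have hdet : (moore p n).det • contr p n j z = 0 := by
    have hadj := congrArg ((moore p n).adjugate • ·) hmoore
    simp only [← mul_smul, Matrix.adjugate_mul, smul_zero] at hadj
    have := congrFun hadj j
    simpa [Matrix.Module.smul_apply, Matrix.one_apply] using this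
  exact (smul_eq_zero.1 hdet).resolve_left det_moore_ne_zero

end KernelOfContractions

section SteenrodClosed

variable {p n : ℕ}

/-- Closed under the Bockstein and all reduced powers. -/
structure IsSteenrodClosed (K : Submodule (ZMod p) (Coh p n)) : Prop where
  bockstein_mem : ∀ z ∈ K, bockstein p n z ∈ K
  power_mem : ∀ k, ∀ z ∈ K, power p n k z ∈ K

variable {K : Submodule (ZMod p) (Coh p n)}

theorem IsSteenrodClosed.comap_incl (hK : IsSteenrodClosed K) :
    IsPowerClosed (K.comap (incl p n).toLinearMap) := fun k q hq => by
  rw [Submodule.mem_comap, AlgHom.toLinearMap_apply] at hq ⊢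
  exact power_incl k q ▸ hK.power_mem k _ hq

variable [Fact p.Prime]

theorem IsSteenrodClosed.milnorQ_mem (hK : IsSteenrodClosed K) (i : ℕ) :
    ∀ z ∈ K, milnorQ p n i z ∈ K := by
  induction i with
  | zero => exact fun z hz => milnorQ_zero z ▸ hK.bockstein_mem z hz
  | succ i ih =>
    intro z hz
    rw [milnorQ_succ]
    exact sub_mem (hK.power_mem _ _ (ih z hz)) (ih _ (hK.power_mem _ _ hz))

theorem milnorQ_milnorQ_self (hp : p ≠ 2) (i : ℕ) (z : Coh p n) :
    milnorQ p n i (milnorQ p n i z) = 0 := by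
  have h2 : (2 : ZMod p) ≠ 0 := Ring.two_ne_zero (by rwa [ZMod.ringChar_zmod_n])
  refine (smul_eq_zero.1 ?_).resolve_left h2
  rw [two_smul]
  exact eq_neg_iff_add_eq_zero.1 (milnorQ_milnorQ i i z)

theorem IsSteenrodClosed.exists_milnorQ_eq_zero (hp : p ≠ 2) (hK : IsSteenrodClosed K)
    (h0 : K ≠ ⊥) (m : ℕ) : ∃ z ∈ K, z ≠ 0 ∧ ∀ i < m, milnorQ p n i z = 0 := by
  induction m with
  | zero =>
    obtain ⟨z, hz, hz0⟩ := Submodule.exists_mem_ne_zero_of_ne_bot h0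
    exact ⟨z, hz, hz0, by simp⟩
  | succ m ih =>
    obtain ⟨z, hz, hz0, hzi⟩ := ih
    simp only [Nat.forall_lt_succ_right]
    by_cases hm : milnorQ p n m z = 0
    · exact ⟨z, hz, hz0, hzi, hm⟩
    · refine ⟨milnorQ p n m z, hK.milnorQ_mem m z hz, hm, fun i hi => ?_,
        milnorQ_milnorQ_self hp m z⟩
      rw [milnorQ_milnorQ, hzi i hi, map_zero, neg_zero]

theorem IsSteenrodClosed.exists_incl_mem (hp : p ≠ 2) (hK : IsSteenrodClosed K) (h0 : K ≠ ⊥) :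
    ∃ q ≠ 0, incl p n q ∈ K := by
  obtain ⟨z, hz, hz0, hzi⟩ := hK.exists_milnorQ_eq_zero hp h0 n
  have hq := eq_incl_of_contr_eq_zero (contr_eq_zero_of_milnorQ_eq_zero hzi)
  refine ⟨exteriorAug p n z, fun h => hz0 ?_, hq ▸ hz⟩
  rw [hq, h, map_zero]

theorem constantCoeff_dicksonCoeff (s : Fin n) :
    MvPolynomial.constantCoeff (dicksonCoeff p n s) = 0 := by
  have hlin (v : Fin n → ZMod p) : MvPolynomial.constantCoeff (linearForm p n v) = 0 := by
    simp [linearForm_apply]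
  have hmap : (dicksonPoly p n).map MvPolynomial.constantCoeff = Polynomial.X ^ p ^ n := by
    simp [dicksonPoly_eq_prod, Polynomial.map_prod, -map_sum, hlin]
  rw [dicksonCoeff, map_neg, ← Polynomial.coeff_map, hmap, Polynomial.coeff_X_pow,
    if_neg (Nat.pow_right_injective (Fact.out : p.Prime).two_le |>.ne s.2.ne), neg_zero]

theorem constantCoeff_dicksonEval (F : Poly p n) :
    MvPolynomial.constantCoeff (dicksonEval p n F) = MvPolynomial.constantCoeff F := by
  induction F using MvPolynomial.induction_on with
  | C a => simp [dicksonEval]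
  | add F G hF hG => simp only [map_add, hF, hG]
  | mul_X F s _ => simp [dicksonEval_X, constantCoeff_dicksonCoeff]

theorem IsSteenrodClosed.exists_forall_dicksonCoeff_pow_mem [NeZero n] (hp : p ≠ 2)
    (hK : IsSteenrodClosed K) (hD : ∀ z ∈ K, exteriorAug p n z ∈ dicksonAlgebra p n)
    (hc : ∀ z ∈ K, MvPolynomial.constantCoeff (exteriorAug p n z) = 0) (h0 : K ≠ ⊥) :
    ∃ k, ∀ j ≥ k, incl p n (dicksonCoeff p n 0 ^ p ^ j) ∈ K := by
  obtain ⟨q, hq0, hq⟩ := hK.exists_incl_mem hp h0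
  obtain ⟨F, rfl⟩ : q ∈ (dicksonEval p n).range := by
    rw [range_dicksonEval, ← exteriorAug_incl (p := p) (n := n) q]
    exact hD _ hq
  have hF : F.coeff 0 = 0 := by
    rw [← MvPolynomial.constantCoeff_eq, ← constantCoeff_dicksonEval,
      ← exteriorAug_incl (p := p) (n := n) (dicksonEval p n F)]
    exact hc _ hq
  have hF0 : F ≠ 0 := by
    rintro rfl
    exact hq0 (map_zero _)
  have hN := hK.comap_incl
  obtain ⟨k, hk⟩ := hN.exists_dicksonCoeff_pow_mem hF0 hF
    (by rwa [Submodule.mem_comap, AlgHom.toLinearMap_apply])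
  refine ⟨k, fun j hj => ?_⟩
  have hmem := hN.dicksonCoeff_zero_pow_mem_of_le hj hk
  rwa [Submodule.mem_comap, AlgHom.toLinearMap_apply] at hmem

end SteenrodClosed

section Alternating

variable {R α β : Type*} [CommRing R] [Fintype α] [DecidableEq α] [Fintype β] [DecidableEq β]
  (B : Matrix (α ⊕ β) (α ⊕ β) R)

theorem det_submatrix_sumElim_inr (f : α → α ⊕ β) :
    (B.submatrix (Sum.elim f .inr) id).det = ∑ σ : Equiv.Perm (α ⊕ β), (Equiv.Perm.sign σ : ℤ) •
      ((∏ b, B (.inr b) (σ (.inr b))) * ∏ a, B (f a) (σ (.inl a))) := by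
  rw [← Matrix.det_transpose, Matrix.det_apply]
  refine Finset.sum_congr rfl fun σ _ => ?_
  rw [Units.smul_def, Fintype.prod_sum_type, mul_comm]
  rfl

theorem det_submatrix_sumElim_inl_perm (π : Equiv.Perm α) :
    (B.submatrix (Sum.elim (fun a => .inl (π a)) .inr) id).det = Equiv.Perm.sign π * B.det := by
  have hB : Sum.elim (fun a => .inl (π a)) .inr = (π.sumCongr (1 : Equiv.Perm β) : α ⊕ β → _) := by
    ext (a | b) <;> rfl
  rw [hB, Matrix.det_permute, Equiv.Perm.sign_sumCongr, map_one, mul_one]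

theorem det_submatrix_sumElim_inr_eq_zero {f : α → α ⊕ β}
    (hf : f ∉ Set.range fun (π : Equiv.Perm α) a => .inl (π a)) :
    (B.submatrix (Sum.elim f .inr) id).det = 0 := by
  by_cases hinj : Function.Injective (Sum.elim f Sum.inr)
  · have hl (a : α) : ∃ a', Sum.inl a' = f a := by
      rcases hfa : f a with a' | b
      · exact ⟨a', rfl⟩
      · exact absurd (@hinj (.inl a) (.inr b) hfa) Sum.inl_ne_inr
    choose π hπ using hl
    have hπ' : Function.Injective π := fun a a' haa => Sum.inl_injective
      (@hinj (.inl a) (.inl a') (by simp only [Sum.elim_inl, ← hπ, haa]))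
    exact absurd ⟨Equiv.ofBijective π (Finite.injective_iff_bijective.1 hπ'), funext hπ⟩ hf
  · obtain ⟨a, b, hab, hne⟩ := Function.not_injective_iff.1 hinj
    exact Matrix.det_zero_of_row_eq hne (funext fun j => congrArg (B · j) hab)

-- Expanding every `z j` by `h` turns the sum over `σ` into a sum of determinants over the maps
-- `f : α → α ⊕ β`, of which only the permutations of `α` survive.
theorem pow_card_smul_sum_sign_smul_alternatingMap {V W : Type*} [AddCommGroup V] [Module R V]
    [AddCommGroup W] [Module R W] (ω : V [⋀^α]→ₗ[R] W) {d : R} {z ξ : α ⊕ β → V}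
    (h : ∀ j, d • z j = ∑ a, B a j • ξ a) :
    d ^ Fintype.card α • ∑ σ : Equiv.Perm (α ⊕ β), (Equiv.Perm.sign σ : ℤ) •
        (∏ b, B (.inr b) (σ (.inr b))) • ω (fun a => z (σ (.inl a))) =
      (Fintype.card α).factorial • B.det • ω (fun a => ξ (.inl a)) := by
  have hω (σ : Equiv.Perm (α ⊕ β)) : d ^ Fintype.card α • ω (fun a => z (σ (.inl a))) =
      ∑ f : α → α ⊕ β, (∏ a, B (f a) (σ (.inl a))) • ω (fun a => ξ (f a)) := by
    rw [← Finset.card_univ, ← Finset.prod_const, ← ω.map_smul_univ]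
    simp only [h]
    exact (ω.toMultilinearMap.map_sum _).trans
      (Finset.sum_congr rfl fun f _ => ω.map_smul_univ _ _)
  have hperm (π : Equiv.Perm α) : B.det • ω (fun a => ξ (.inl a)) =
      (B.submatrix (Sum.elim (fun a => .inl (π a)) .inr) id).det •
        ω (fun a => ξ (.inl (π a))) := by
    have hπ : ω (fun a => ξ (.inl (π a))) = Equiv.Perm.sign π • ω (fun a => ξ (.inl a)) :=
      ω.map_perm (fun a => ξ (.inl a)) π
    rw [hπ, det_submatrix_sumElim_inl_perm, mul_smul, Units.smul_def, Int.cast_smul_eq_zsmul,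
      smul_comm B.det, smul_smul, ← Units.val_mul, Int.units_mul_self, Units.val_one, one_smul]
  have hinj : Function.Injective fun (π : Equiv.Perm α) (a : α) => (.inl (π a) : α ⊕ β) :=
    fun π π' h => Equiv.ext fun a => Sum.inl_injective (congrFun h a)
  calc
    _ = ∑ f : α → α ⊕ β, (B.submatrix (Sum.elim f .inr) id).det • ω (fun a => ξ (f a)) := by
      simp only [det_submatrix_sumElim_inr, Finset.sum_smul, Finset.smul_sum]
      rw [Finset.sum_comm]
      refine Finset.sum_congr rfl fun σ _ => ?_
      rw [smul_comm, smul_comm (d ^ _), hω, Finset.smul_sum, Finset.smul_sum]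
      simp only [smul_assoc, mul_smul]
    _ = ∑ _π : Equiv.Perm α, B.det • ω (fun a => ξ (.inl a)) :=
      (Fintype.sum_of_injective _ hinj _ _
        (fun f hf => by rw [det_submatrix_sumElim_inr_eq_zero B hf, zero_smul]) hperm).symm
    _ = _ := by rw [Finset.sum_const, Finset.card_univ, Fintype.card_perm]

end Alternating

section MuiInvariants

variable {p n : ℕ}

variable (p n) in
/-- The linear forms `∑ j, q_j x_j` in the exterior generators, with polynomial coefficients. -/
def exteriorForm : (Fin n → Poly p n) →ₗ[Poly p n] Coh p n :=
  Fintype.linearCombination (Poly p n) (x p n)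

variable (p n) in
/-- `∑ j, adj(A)_{j s} x_j` for the Moore matrix `A`; up to sign, this is `M_{n;s}`. -/
def xi (s : Fin n) : Coh p n := exteriorForm p n fun j => (moore p n).adjugate j s

theorem exteriorForm_apply (v : Fin n → Poly p n) :
    exteriorForm p n v = ∑ j, v j • x p n j :=
  Fintype.linearCombination_apply ..

theorem exteriorForm_single_one (j : Fin n) : exteriorForm p n (Pi.single j 1) = x p n j := by
  rw [exteriorForm, Fintype.linearCombination_apply_single, one_smul]

theorem x_mul_self (j : Fin n) : x p n j * x p n j = 0 := by
  rw [x, Algebra.TensorProduct.tmul_mul_tmul, ExteriorAlgebra.ι_sq_zero, TensorProduct.zero_tmul]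

theorem exteriorForm_mul_self (v : Fin n → Poly p n) :
    exteriorForm p n v * exteriorForm p n v = 0 := by
  rw [exteriorForm_apply]
  induction (Finset.univ : Finset (Fin n)) using Finset.induction_on with
  | empty => rw [Finset.sum_empty, mul_zero]
  | insert j s hj ih =>
    have hanti : (∑ i ∈ s, v i • x p n i) * (v j • x p n j) =
        -((v j • x p n j) * ∑ i ∈ s, v i • x p n i) := by
      simp only [Finset.sum_mul, Finset.mul_sum, ← Finset.sum_neg_distrib]
      refine Finset.sum_congr rfl fun i _ => ?_
      rw [smul_mul_smul_comm, smul_mul_smul_comm, x_mul_x, smul_neg, mul_comm]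
    rw [Finset.sum_insert hj, add_mul, mul_add, mul_add, ih, hanti, smul_mul_smul_comm, x_mul_self,
      smul_zero, zero_add, add_zero, add_neg_cancel]

variable (p n) in
/-- The product of `m` linear forms in the exterior generators, as an alternating map. -/
def exteriorFormProd (m : ℕ) : (Fin n → Poly p n) [⋀^Fin m]→ₗ[Poly p n] Coh p n :=
  (ExteriorAlgebra.lift (Poly p n)
    ⟨exteriorForm p n, exteriorForm_mul_self⟩).toLinearMap.compAlternatingMap
      (ExteriorAlgebra.ιMulti (Poly p n) m)

theorem exteriorFormProd_apply {m : ℕ} (v : Fin m → Fin n → Poly p n) :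
    exteriorFormProd p n m v = (List.ofFn fun a => exteriorForm p n (v a)).prod := by
  rw [exteriorFormProd, LinearMap.compAlternatingMap_apply, AlgHom.toLinearMap_apply,
    ExteriorAlgebra.ιMulti_apply, map_list_prod, List.map_ofFn]
  congr 2
  funext a
  exact ExteriorAlgebra.lift_ι_apply ..

theorem det_moore_smul_single (j : Fin n) : (moore p n).det • (Pi.single j 1 : Fin n → Poly p n) =
    ∑ a, moore p n a j • fun i => (moore p n).adjugate i a := by
  ext1 i
  have h := congrFun₂ (Matrix.adjugate_mul (moore p n)) i j
  rw [Matrix.mul_apply, Matrix.smul_apply, Matrix.one_apply] at h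
  rw [Pi.smul_apply, Pi.single_apply, ← h, Finset.sum_apply]
  exact Finset.sum_congr rfl fun a _ => mul_comm _ _

theorem exists_injective_val_eq_nth_notMem {S : Finset ℕ} {k : ℕ} (hS : ∀ s ∈ S, s < n)
    (hk : S.card + k = n) :
    ∃ g : Fin k → Fin n, Function.Injective g ∧
      ∀ i, (g i : ℕ) ∉ S ∧ (g i : ℕ) = Nat.nth (fun t => t ∉ S) i := by
  have hinf : (Set.ofPred fun t : ℕ => t ∉ S).Infinite := S.finite_toSet.infinite_compl
  have hcount : Nat.count (fun t => t ∉ S) n = k := by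
    rw [Nat.count_eq_card_filter_range, Finset.filter_notMem_eq_sdiff,
      Finset.card_sdiff_of_subset fun s hs => Finset.mem_range.2 (hS s hs), Finset.card_range]
    omega
  exact ⟨fun i => ⟨Nat.nth (fun t => t ∉ S) i, Nat.nth_lt_of_lt_count (hcount.symm ▸ i.2)⟩,
    fun i j h => Fin.ext ((Nat.nth_strictMono hinf).injective (Fin.mk.inj_iff.1 h)), fun i =>
    ⟨Nat.nth_mem_of_infinite hinf i, rfl⟩⟩

theorem exists_det_submatrix_equiv_eq {ι κ R : Type*} [Fintype ι] [DecidableEq ι] [Fintype κ]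
    [DecidableEq κ] [CommRing R] (A : Matrix κ κ R) (e f : ι ≃ κ) :
    ∃ ε : ℤˣ, (A.submatrix e f).det = (ε : ℤ) • A.det := by
  refine ⟨Equiv.Perm.sign (f.symm.trans e), ?_⟩
  have h : A.submatrix e f = (A.submatrix (f.symm.trans e) id).submatrix f f := by
    ext i j
    simp
  rw [h, Matrix.det_submatrix_equiv_self, Matrix.det_permute, zsmul_eq_mul]

theorem prod_ofFn_incl {k : ℕ} (f : Fin k → Poly p n) :
    (List.ofFn fun i => incl p n (f i)).prod = incl p n (∏ i, f i) := by
  rw [← List.prod_ofFn, map_list_prod, List.map_ofFn]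
  rfl

theorem M_eq_sum_exteriorFormProd {m k : ℕ} {S : Finset ℕ} (hS : S.card = m)
    {g : Fin k → Fin (m + k)} (hg : ∀ i, (g i : ℕ) = Nat.nth (fun t => t ∉ S) i) :
    M p (m + k) S = (m.factorial : ZMod p)⁻¹ • ∑ σ : Equiv.Perm (Fin m ⊕ Fin k),
      (Equiv.Perm.sign σ : ℤ) • (∏ b, moore p (m + k) (g b) (finSumFinEquiv (σ (.inr b)))) •
        exteriorFormProd p (m + k) m (fun a => Pi.single (finSumFinEquiv (σ (.inl a))) 1) := by
  rw [M, rowDet, hS, ← finSumFinEquiv.permCongr.sum_comp]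
  congr 1
  refine Finset.sum_congr rfl fun σ _ => ?_
  rw [Equiv.Perm.sign_permCongr, List.ofFn_add, List.prod_append]
  congr 1
  rw [← mul_incl, exteriorFormProd_apply, ← prod_ofFn_incl]
  have hcast (h : m ≤ m + k) (a : Fin m) : finSumFinEquiv.symm (Fin.castLE h a) = .inl a :=
    finSumFinEquiv_symm_apply_castAdd a
  simp [exteriorForm_single_one, moore_apply, y, hg, hcast]

variable [Fact p.Prime]

theorem det_moore_pow_smul_M {m : ℕ} (hm : m < p) {s : Fin m → Fin n} (hs : Function.Injective s) :
    ∃ ε : ℤˣ, (moore p n).det ^ m • M p n (Finset.univ.image fun a => (s a : ℕ)) =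
      (ε : ℤ) • (moore p n).det • (List.ofFn fun a => xi p n (s a)).prod := by
  set S : Finset ℕ := Finset.univ.image fun a => (s a : ℕ) with hS
  have hcard : S.card = m := by
    rw [hS, Finset.card_image_of_injective _ fun a b h => hs (Fin.ext h), Finset.card_univ,
      Fintype.card_fin]
  obtain ⟨k, rfl⟩ := Nat.exists_eq_add_of_le (by simpa using Fintype.card_le_of_injective s hs)
  obtain ⟨g, hg, hgS⟩ := exists_injective_val_eq_nth_notMem (n := m + k) (S := S)
    (by simp [hS]) (by rw [hcard])
  have hpos : Function.Injective (Sum.elim s g) := hs.sumElim hg fun a b hab => (hgS b).1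
    (Finset.mem_image.2 ⟨a, Finset.mem_univ a, congrArg Fin.val hab⟩)
  let e := Equiv.ofBijective _ ((Fintype.bijective_iff_injective_and_card _).2 ⟨hpos, by simp⟩)
  obtain ⟨ε, hε⟩ := exists_det_submatrix_equiv_eq (moore p (m + k)) e finSumFinEquiv
  have hm0 : (m.factorial : ZMod p) ≠ 0 := by
    rw [Ne, ZMod.natCast_eq_zero_iff, (Fact.out : p.Prime).dvd_factorial]
    omega
  have hexp := pow_card_smul_sum_sign_smul_alternatingMap
    ((moore p (m + k)).submatrix e finSumFinEquiv) (exteriorFormProd p (m + k) m)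
    (z := fun j => Pi.single (finSumFinEquiv j) 1)
    (ξ := fun a i => (moore p (m + k)).adjugate i (e a)) fun j => by
      rw [det_moore_smul_single, ← e.sum_comp]
      rfl
  refine ⟨ε, ?_⟩
  rw [Fintype.card_fin, hε, exteriorFormProd_apply] at hexp
  rw [M_eq_sum_exteriorFormProd hcard fun i => (hgS i).2, smul_comm, inv_smul_eq_iff₀ hm0,
    Nat.cast_smul_eq_nsmul, ← smul_assoc (ε : ℤ)]
  exact hexp

end MuiInvariants

section Generators

theorem mem_iff_of_eq_units_zsmul {A σ : Type*} [AddGroup A] [SetLike σ A] [AddSubgroupClass σ A]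
    {N : σ} {z w : A} (h : ∃ ε : ℤˣ, z = (ε : ℤ) • w) : z ∈ N ↔ w ∈ N := by
  obtain ⟨ε, rfl⟩ := h
  rcases Int.units_eq_one_or ε with rfl | rfl <;> simp

variable {p n : ℕ}

variable (p n) in
/-- Up to sign, the generator `M_{n;s} L_n^{p-2}`. -/
def muiGen (s : Fin n) : Coh p n := (moore p n).det ^ (p - 2) • xi p n s

variable (p n) in
/-- Up to sign, the generator `M_{n;s,t} L_n^{p-2}`. -/
def muiGenPair (s t : Fin n) : Coh p n := (moore p n).det ^ (p - 3) • (xi p n s * xi p n t)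

theorem xi_mul_self (s : Fin n) : xi p n s * xi p n s = 0 := exteriorForm_mul_self _

theorem xi_mul_xi (s t : Fin n) : xi p n s * xi p n t = -(xi p n t * xi p n s) := by
  have h := exteriorForm_mul_self (p := p) (n := n)
    ((fun j => (moore p n).adjugate j s) + fun j => (moore p n).adjugate j t)
  rw [map_add, add_mul, mul_add, mul_add, exteriorForm_mul_self, exteriorForm_mul_self, zero_add,
    add_zero] at h
  exact eq_neg_of_add_eq_zero_left h

theorem muiGenPair_self (s : Fin n) : muiGenPair p n s s = 0 := by
  rw [muiGenPair, xi_mul_self, smul_zero]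

theorem muiGenPair_swap (s t : Fin n) : muiGenPair p n s t = -muiGenPair p n t s := by
  rw [muiGenPair, muiGenPair, xi_mul_xi, smul_neg]

theorem exteriorAug_xi (s : Fin n) : exteriorAug p n (xi p n s) = 0 := by
  simp [xi, exteriorForm_apply, exteriorAug_smul, exteriorAug_x]

theorem exteriorAug_muiGen (s : Fin n) : exteriorAug p n (muiGen p n s) = 0 := by
  rw [muiGen, exteriorAug_smul, exteriorAug_xi, mul_zero]

theorem exteriorAug_muiGenPair (s t : Fin n) : exteriorAug p n (muiGenPair p n s t) = 0 := by
  rw [muiGenPair, exteriorAug_smul, map_mul, exteriorAug_xi, zero_mul, mul_zero]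

theorem gradeInvol_xi (s : Fin n) : gradeInvol p n (xi p n s) = -xi p n s := by
  simp [xi, exteriorForm_apply, gradeInvol_smul, gradeInvol_x]

theorem gradeInvol_muiGen (s : Fin n) : gradeInvol p n (muiGen p n s) = -muiGen p n s := by
  rw [muiGen, gradeInvol_smul, gradeInvol_xi, smul_neg]

theorem gradeInvol_muiGenPair (s t : Fin n) :
    gradeInvol p n (muiGenPair p n s t) = muiGenPair p n s t := by
  rw [muiGenPair, gradeInvol_smul, map_mul, gradeInvol_xi, gradeInvol_xi]
  congr 1
  exact neg_mul_neg (xi p n s) (xi p n t)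

theorem bockstein_xi [NeZero n] (s : Fin n) :
    bockstein p n (xi p n s) = if s = 0 then incl p n (moore p n).det else 0 := by
  have h := congrFun₂ (Matrix.mul_adjugate (moore p n)) 0 s
  rw [Matrix.mul_apply, Matrix.smul_apply, Matrix.one_apply] at h
  calc
    _ = incl p n (∑ j, moore p n 0 j * (moore p n).adjugate j s) := by
      simp only [xi, exteriorForm_apply, map_sum, bockstein_smul, bockstein_x]
      refine Finset.sum_congr rfl fun j _ => ?_
      rw [← incl_mul, ← map_mul, moore_apply, mul_comm]
      simp
    _ = _ := by
      rw [h]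
      simp [eq_comm, apply_ite (incl p n)]

theorem bockstein_muiGenPair [NeZero n] (h2 : 3 ≤ p) (s t : Fin n) :
    bockstein p n (muiGenPair p n s t) =
      (if s = 0 then muiGen p n t else 0) - if t = 0 then muiGen p n s else 0 := by
  have hdet (z : Coh p n) :
      (moore p n).det ^ (p - 3) • (moore p n).det • z = (moore p n).det ^ (p - 2) • z := by
    rw [smul_smul, ← pow_succ]
    congr 2
    omega
  rw [muiGenPair, bockstein_smul, bockstein_mul, bockstein_xi, bockstein_xi, gradeInvol_xi]
  split_ifs <;> simp [incl_mul, mul_incl, hdet, muiGen, sub_eq_add_neg]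

theorem bockstein_muiGen [NeZero n] (h2 : 2 ≤ p) (s : Fin n) : bockstein p n (muiGen p n s) =
    if s = 0 then incl p n ((moore p n).det ^ (p - 1)) else 0 := by
  rw [muiGen, bockstein_smul, bockstein_xi, smul_ite, smul_zero, ← incl_mul, ← map_mul, ← pow_succ]
  congr 4
  omega

theorem exists_incl_det_moore_pow_eq [Fact p.Prime] [NeZero n] :
    ∃ ε : ℤˣ, incl p n ((moore p n).det ^ (p - 1)) = (ε : ℤ) • incl p n (dicksonCoeff p n 0) := by
  refine ⟨(finRotate n).sign, ?_⟩
  rw [dicksonCoeff_zero_eq, ← zsmul_eq_mul, map_zsmul, smul_smul, ← Units.val_mul,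
    Int.units_mul_self, Units.val_one, one_smul]

theorem exists_dickson_eq [NeZero p] (s : Fin n) {i : ℕ} (hi : i + s = n) :
    ∃ ε : ℤˣ, dickson p n i = (ε : ℤ) • incl p n (dicksonCoeff p n s) := by
  refine ⟨(-1) ^ (i + 1), ?_⟩
  rw [← map_zsmul, dickson, dicksonCoeff, show n - i = s by omega, zsmul_eq_mul]
  congr 1
  push_cast
  ring

variable [Fact p.Prime]

theorem exists_M_mul_L_pow_eq {m : ℕ} (hm : m < p) {s : Fin m → Fin n}
    (hs : Function.Injective s) : ∃ ε : ℤˣ,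
    M p n (Finset.univ.image fun a => (s a : ℕ)) * L p n ^ (p - 2) =
      (ε : ℤ) • (moore p n).det ^ (p - 1 - m) • (List.ofFn fun a => xi p n (s a)).prod := by
  obtain ⟨ε, hε⟩ := det_moore_pow_smul_M hm hs
  refine ⟨ε, smul_right_injective _ (pow_ne_zero m (det_moore_ne_zero (p := p) (n := n))) ?_⟩
  have h2 := (Fact.out : p.Prime).two_le
  simp only
  rw [L_eq_incl_det_moore, ← map_pow, mul_incl, smul_comm, hε, smul_comm (_ ^ m), smul_smul (_ ^ m),
    ← pow_add, smul_comm, smul_smul, ← pow_succ]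
  congr 3
  omega

theorem exists_M_singleton_mul_eq (s : Fin n) :
    ∃ ε : ℤˣ, M p n {(s : ℕ)} * L p n ^ (p - 2) = (ε : ℤ) • muiGen p n s := by
  obtain ⟨ε, hε⟩ := exists_M_mul_L_pow_eq (Fact.out : p.Prime).one_lt
    (Function.injective_of_subsingleton (f := ![s]))
  exact ⟨ε, by simpa [muiGen, Nat.sub_sub] using hε⟩

theorem exists_M_pair_mul_eq (hp : p ≠ 2) {s t : Fin n} (hst : s ≠ t) :
    ∃ ε : ℤˣ, M p n {(s : ℕ), (t : ℕ)} * L p n ^ (p - 2) = (ε : ℤ) • muiGenPair p n s t := by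
  have h2 := (Fact.out : p.Prime).two_le
  obtain ⟨ε, hε⟩ := exists_M_mul_L_pow_eq (m := 2) (by omega : 2 < p) (s := ![s, t])
    (by simpa [Function.Injective, Fin.forall_fin_two, eq_comm] using hst)
  refine ⟨ε, ?_⟩
  simpa [muiGenPair, Nat.sub_sub, Finset.univ_fin2] using hε

theorem incl_dicksonCoeff_mem (s : Fin n) : incl p n (dicksonCoeff p n s) ∈ SD p n :=
  (mem_iff_of_eq_units_zsmul (exists_dickson_eq s (i := n - 1 - s + 1) (by omega))).1
    (Algebra.subset_adjoin (Or.inl (Or.inl ⟨n - 1 - s, by omega, rfl⟩)))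

theorem incl_mem_SD {q : Poly p n} (hq : q ∈ dicksonAlgebra p n) : incl p n q ∈ SD p n :=
  (Algebra.adjoin_le (Set.range_subset_iff.2 incl_dicksonCoeff_mem) :
    dicksonAlgebra p n ≤ (SD p n).comap (incl p n)) hq

theorem muiGen_mem (s : Fin n) : muiGen p n s ∈ SD p n :=
  (mem_iff_of_eq_units_zsmul (exists_M_singleton_mul_eq s)).1
    (Algebra.subset_adjoin (Or.inl (Or.inr ⟨s, s.2, rfl⟩)))

theorem muiGenPair_mem (hp : p ≠ 2) (s t : Fin n) : muiGenPair p n s t ∈ SD p n := by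
  have of_lt {s t : Fin n} (hst : s < t) : muiGenPair p n s t ∈ SD p n :=
    (mem_iff_of_eq_units_zsmul (exists_M_pair_mul_eq hp hst.ne)).1
      (Algebra.subset_adjoin (Or.inr ⟨s, t, hst, t.2, rfl⟩))
  rcases lt_trichotomy s t with hst | rfl | hst
  · exact of_lt hst
  · rw [muiGenPair_self]
    exact zero_mem _
  · rw [muiGenPair_swap]
    exact neg_mem (of_lt hst)

theorem SD_le (hp : p ≠ 2) {S : Subalgebra (ZMod p) (Coh p n)}
    (hdickson : ∀ s, incl p n (dicksonCoeff p n s) ∈ S) (hmui : ∀ s, muiGen p n s ∈ S)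
    (hmuiPair : ∀ s t, muiGenPair p n s t ∈ S) : SD p n ≤ S := by
  refine Algebra.adjoin_le ?_
  rintro z ((⟨s, hs, rfl⟩ | ⟨s, hs, rfl⟩) | ⟨s, t, hst, ht, rfl⟩)
  · exact (mem_iff_of_eq_units_zsmul
      (exists_dickson_eq ⟨n - 1 - s, by omega⟩ (by simp only; omega))).2 (hdickson _)
  · exact (mem_iff_of_eq_units_zsmul (exists_M_singleton_mul_eq ⟨s, hs⟩)).2 (hmui _)
  · exact (mem_iff_of_eq_units_zsmul (exists_M_pair_mul_eq hp (s := ⟨s, hst.trans ht⟩)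
      (t := ⟨t, ht⟩) (Fin.ne_of_lt hst))).2 (hmuiPair _ _)

theorem exteriorAug_mem (hp : p ≠ 2) {z : Coh p n} (hz : z ∈ SD p n) :
    exteriorAug p n z ∈ dicksonAlgebra p n := by
  refine SD_le hp (S := (dicksonAlgebra p n).comap (exteriorAug p n)) (fun s => ?_)
    (fun s => ?_) (fun s t => ?_) hz <;> rw [Subalgebra.mem_comap]
  · rw [exteriorAug_incl]
    exact Algebra.subset_adjoin ⟨s, rfl⟩
  · rw [exteriorAug_muiGen]
    exact zero_mem _
  · rw [exteriorAug_muiGenPair]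
    exact zero_mem _

theorem gradeInvol_mem (hp : p ≠ 2) {z : Coh p n} (hz : z ∈ SD p n) :
    gradeInvol p n z ∈ SD p n := by
  refine SD_le hp (S := (SD p n).comap (gradeInvol p n)) (fun s => ?_)
    (fun s => ?_) (fun s t => ?_) hz <;> rw [Subalgebra.mem_comap]
  · rw [gradeInvol_incl]
    exact incl_dicksonCoeff_mem s
  · rw [gradeInvol_muiGen]
    exact neg_mem (muiGen_mem s)
  · rw [gradeInvol_muiGenPair]
    exact muiGenPair_mem hp s t

variable (p n) in
/-- The span of the generators of the ideal `I_n`. -/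
def idealGens : Submodule (ZMod p) (Coh p n) :=
  Submodule.span (ZMod p)
    ({dickson p n n} ∪ {z | ∃ i < n, z = M p n {i} * L p n ^ (p - 2)} ∪
      {z | ∃ i, 0 < i ∧ i < n ∧ z = M p n {0, i} * L p n ^ (p - 2)})

theorem muiGen_mem_idealGens (s : Fin n) : muiGen p n s ∈ idealGens p n :=
  (mem_iff_of_eq_units_zsmul (exists_M_singleton_mul_eq s)).1
    (Submodule.subset_span (Or.inl (Or.inr ⟨s, s.2, rfl⟩)))

variable [NeZero n]

theorem incl_dicksonCoeff_zero_mem_idealGens :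
    incl p n (dicksonCoeff p n 0) ∈ idealGens p n :=
  (mem_iff_of_eq_units_zsmul (exists_dickson_eq 0 (by simp))).1
    (Submodule.subset_span (Or.inl (Or.inl rfl)))

theorem muiGenPair_mem_idealGens (hp : p ≠ 2) (t : Fin n) :
    muiGenPair p n 0 t ∈ idealGens p n := by
  rcases eq_or_ne 0 t with rfl | ht
  · rw [muiGenPair_self]
    exact zero_mem _
  · exact (mem_iff_of_eq_units_zsmul (exists_M_pair_mul_eq hp ht)).1 (Submodule.subset_span
      (Or.inr ⟨t, Nat.pos_of_ne_zero fun h => ht (Fin.ext (by simp [h])), t.2, by simp⟩))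

theorem idealGens_le (hp : p ≠ 2) {N : Submodule (ZMod p) (Coh p n)}
    (hdickson : incl p n (dicksonCoeff p n 0) ∈ N) (hmui : ∀ s, muiGen p n s ∈ N)
    (hmuiPair : ∀ t, muiGenPair p n 0 t ∈ N) : idealGens p n ≤ N := by
  refine Submodule.span_le.2 ?_
  rintro z ((rfl | ⟨s, hs, rfl⟩) | ⟨t, ht0, ht, rfl⟩)
  · exact (mem_iff_of_eq_units_zsmul (exists_dickson_eq 0 (by simp))).2 hdickson
  · exact (mem_iff_of_eq_units_zsmul (exists_M_singleton_mul_eq ⟨s, hs⟩)).2 (hmui _)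
  · have h := exists_M_pair_mul_eq (p := p) hp (s := 0) (t := ⟨t, ht⟩)
      (Fin.ne_of_lt (by simpa [Fin.lt_def] using ht0))
    rw [Fin.val_zero] at h
    exact (mem_iff_of_eq_units_zsmul h).2 (hmuiPair _)

end Generators

section ReducedPowers

variable {p n : ℕ}

theorem power_mul (k : ℕ) (u v : Coh p n) :
    power p n k (u * v) =
      ∑ ij ∈ Finset.HasAntidiagonal.antidiagonal k, power p n ij.1 u * power p n ij.2 v := by
  simp only [← coeff_cohPower, map_mul, Polynomial.coeff_mul]

variable [Fact p.Prime]

variable (p n) in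
/-- The inclusion of the Dickson algebra into `Coh p n`, applied to the coefficients of
polynomials. -/
def dicksonIncl : (dicksonAlgebra p n)[X] →+* (Coh p n)[X] :=
  Polynomial.mapRingHom ((incl p n).toRingHom.comp (algebraMap (dicksonAlgebra p n) (Poly p n)))

theorem coeff_dicksonIncl_mul_C (F : (dicksonAlgebra p n)[X]) (z : Coh p n) (k : ℕ) :
    (dicksonIncl p n F * Polynomial.C z).coeff k = F.coeff k • z := by
  rw [Polynomial.coeff_mul_C, dicksonIncl, Polynomial.coe_mapRingHom, Polynomial.coeff_map]
  exact incl_mul _ z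

theorem commute_dicksonIncl_C (F : (dicksonAlgebra p n)[X]) (z : Coh p n) :
    Commute (dicksonIncl p n F) (Polynomial.C z) := by
  ext k
  rw [coeff_dicksonIncl_mul_C, Polynomial.coeff_C_mul, dicksonIncl, Polynomial.coe_mapRingHom,
    Polynomial.coeff_map]
  exact (mul_incl _ z).symm

theorem dicksonIncl_mul_C_mul_dicksonIncl_mul_C (F G : (dicksonAlgebra p n)[X]) (z w : Coh p n) :
    dicksonIncl p n F * Polynomial.C z * (dicksonIncl p n G * Polynomial.C w) =
      dicksonIncl p n (F * G) * Polynomial.C (z * w) := by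
  rw [(commute_dicksonIncl_C G z).symm.mul_mul_mul_comm, map_mul, Polynomial.C_mul]

theorem algebraMap_comp_dicksonGen :
    algebraMap (dicksonAlgebra p n) (Poly p n) ∘ dicksonGen p n = dicksonCoeff p n := rfl

theorem map_incl_map_algebraMap (F : (dicksonAlgebra p n)[X]) :
    (F.map (algebraMap (dicksonAlgebra p n) (Poly p n))).map (incl p n).toRingHom =
      dicksonIncl p n F :=
  Polynomial.map_map ..

theorem cohPower_incl_det_moore_pow (m : ℕ) :
    cohPower p n (incl p n ((moore p n).det ^ m)) =
      dicksonIncl p n ((powerMatrix p (dicksonGen p n)).det ^ m) *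
        Polynomial.C (incl p n ((moore p n).det ^ m)) := by
  rw [cohPower_incl, map_pow, totalPower_det_moore, ← algebraMap_comp_dicksonGen,
    det_powerMatrix_comp, mul_pow, ← Polynomial.C_pow,
    ← Polynomial.map_pow, Polynomial.map_mul, map_incl_map_algebraMap, Polynomial.map_C]
  rfl

theorem cohPower_xi (s : Fin n) : cohPower p n (xi p n s) =
    ∑ t, dicksonIncl p n ((powerMatrix p (dicksonGen p n)).adjugate t s) *
      Polynomial.C (xi p n t) := by
  have hterm (j t : Fin n) : (Polynomial.C ((moore p n).adjugate j t) *
        (powerMatrix p (dicksonCoeff p n)).adjugate t s).map (incl p n).toRingHom *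
          Polynomial.C (x p n j) =
      dicksonIncl p n ((powerMatrix p (dicksonGen p n)).adjugate t s) *
        Polynomial.C ((moore p n).adjugate j t • x p n j) := by
    rw [mul_comm, Polynomial.map_mul, ← algebraMap_comp_dicksonGen,
      adjugate_powerMatrix_comp, map_incl_map_algebraMap, Polynomial.map_C, mul_assoc,
      ← Polynomial.C_mul]
    exact congrArg (_ * Polynomial.C ·) (incl_mul _ _)
  have hpower (j : Fin n) : cohPower p n ((moore p n).adjugate j s • x p n j) =
      ∑ t, dicksonIncl p n ((powerMatrix p (dicksonGen p n)).adjugate t s) *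
        Polynomial.C ((moore p n).adjugate j t • x p n j) := by
    rw [← incl_mul, map_mul, cohPower_incl, cohPower_x, totalPower_adjugate_moore,
      Polynomial.map_sum, Finset.sum_mul]
    exact Finset.sum_congr rfl fun t _ => hterm j t
  simp only [xi, exteriorForm_apply, map_sum, hpower, Finset.mul_sum]
  exact Finset.sum_comm

theorem power_incl_det_moore_pow (k m : ℕ) :
    power p n k (incl p n ((moore p n).det ^ m)) =
      ((powerMatrix p (dicksonGen p n)).det ^ m).coeff k • incl p n ((moore p n).det ^ m) := by
  rw [← coeff_cohPower, cohPower_incl_det_moore_pow, coeff_dicksonIncl_mul_C]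

theorem power_muiGen (k : ℕ) (s : Fin n) :
    power p n k (muiGen p n s) =
      ∑ t, ((powerMatrix p (dicksonGen p n)).det ^ (p - 2) *
        (powerMatrix p (dicksonGen p n)).adjugate t s).coeff k • muiGen p n t := by
  rw [← coeff_cohPower, muiGen, ← incl_mul, map_mul, cohPower_incl_det_moore_pow, cohPower_xi,
    Finset.mul_sum, Polynomial.finsetSum_coeff]
  simp only [dicksonIncl_mul_C_mul_dicksonIncl_mul_C, coeff_dicksonIncl_mul_C, incl_mul, muiGen]

theorem power_muiGenPair (k : ℕ) (s t : Fin n) :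
    power p n k (muiGenPair p n s t) =
      ∑ a, ∑ b, ((powerMatrix p (dicksonGen p n)).det ^ (p - 3) *
        ((powerMatrix p (dicksonGen p n)).adjugate a s *
          (powerMatrix p (dicksonGen p n)).adjugate b t)).coeff k • muiGenPair p n a b := by
  rw [← coeff_cohPower, muiGenPair, ← incl_mul, map_mul, map_mul, cohPower_incl_det_moore_pow,
    cohPower_xi, cohPower_xi, Finset.sum_mul_sum]
  simp only [Finset.mul_sum, Polynomial.finsetSum_coeff, dicksonIncl_mul_C_mul_dicksonIncl_mul_C,
    coeff_dicksonIncl_mul_C, incl_mul, muiGenPair]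

end ReducedPowers

section Closure

variable {p n : ℕ} [Fact p.Prime]

theorem smul_mem_SD (d : dicksonAlgebra p n) {z : Coh p n} (hz : z ∈ SD p n) : d • z ∈ SD p n :=
  incl_mul (d : Poly p n) z ▸ mul_mem (incl_mem_SD d.2) hz

theorem power_mem_SD (hp : p ≠ 2) {z : Coh p n} (hz : z ∈ SD p n) (k : ℕ) :
    power p n k z ∈ SD p n := by
  let S : Subalgebra (ZMod p) (Coh p n) :=
    { carrier := {z | ∀ k, power p n k z ∈ SD p n}
      mul_mem' := fun ha hb k => by
        rw [power_mul]
        exact sum_mem fun _ _ => mul_mem (ha _) (hb _)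
      add_mem' := fun ha hb k => by
        rw [map_add]
        exact add_mem (ha k) (hb k)
      algebraMap_mem' := fun r k => by
        rw [← AlgHom.commutes (incl p n), power_incl, polyPower_apply]
        exact incl_mem_SD (coeff_totalPower_mem (Subalgebra.algebraMap_mem _ r) k) }
  refine SD_le hp (S := S) (fun s k => ?_) (fun s k => ?_) (fun s t k => ?_) hz k
  · rw [power_incl, polyPower_apply]
    exact incl_mem_SD (coeff_totalPower_mem (dicksonGen p n s).2 k)
  · rw [power_muiGen]
    exact sum_mem fun t _ => smul_mem_SD _ (muiGen_mem t)
  · rw [power_muiGenPair]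
    exact sum_mem fun a _ => sum_mem fun b _ => smul_mem_SD _ (muiGenPair_mem hp a b)

theorem mul_mem_idealI {u z : Coh p n} (hu : u ∈ SD p n) (hz : z ∈ idealI p n) :
    u * z ∈ idealI p n := by
  have h := Submodule.mul_mem_mul (M := Subalgebra.toSubmodule (SD p n)) hu hz
  rwa [idealI, ← mul_assoc, ← mul_assoc, (SD p n).isIdempotentElem_toSubmodule.eq] at h

theorem idealI_mul_mem {z v : Coh p n} (hz : z ∈ idealI p n) (hv : v ∈ SD p n) :
    z * v ∈ idealI p n := by
  have h := Submodule.mul_mem_mul (N := Subalgebra.toSubmodule (SD p n)) hz hv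
  rwa [idealI, mul_assoc, (SD p n).isIdempotentElem_toSubmodule.eq] at h

theorem idealGens_le_idealI : idealGens p n ≤ idealI p n := fun g hg => by
  have hone : (1 : Coh p n) ∈ Subalgebra.toSubmodule (SD p n) := one_mem (SD p n)
  have h := Submodule.mul_mem_mul (Submodule.mul_mem_mul hone hg) hone
  rwa [one_mul, mul_one] at h

theorem idealI_le {N : Submodule (ZMod p) (Coh p n)} (hgens : idealGens p n ≤ N)
    (hleft : ∀ u ∈ SD p n, ∀ z ∈ N, u * z ∈ N) (hright : ∀ z ∈ N, ∀ v ∈ SD p n, z * v ∈ N) :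
    idealI p n ≤ N :=
  Submodule.mul_le.2 fun z hz v hv =>
    hright z (Submodule.mul_le.2 (fun u hu g hg => hleft u hu g (hgens hg)) hz) v hv

theorem smul_mem_idealI (d : dicksonAlgebra p n) {z : Coh p n} (hz : z ∈ idealI p n) :
    d • z ∈ idealI p n :=
  incl_mul (d : Poly p n) z ▸ mul_mem_idealI (incl_mem_SD d.2) hz

variable [NeZero n]

theorem bockstein_muiGen_mem {N : Submodule (ZMod p) (Coh p n)}
    (hN : incl p n (dicksonCoeff p n 0) ∈ N) (s : Fin n) : bockstein p n (muiGen p n s) ∈ N := by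
  rw [bockstein_muiGen (Fact.out : p.Prime).two_le]
  split_ifs
  exacts [(mem_iff_of_eq_units_zsmul exists_incl_det_moore_pow_eq).2 hN, zero_mem _]

theorem bockstein_muiGenPair_mem (hp : p ≠ 2) {N : Submodule (ZMod p) (Coh p n)}
    (hN : ∀ s, muiGen p n s ∈ N) (s t : Fin n) : bockstein p n (muiGenPair p n s t) ∈ N := by
  rw [bockstein_muiGenPair ((Fact.out : p.Prime).two_le.lt_of_ne' hp)]
  refine sub_mem ?_ ?_ <;> split_ifs
  exacts [hN t, zero_mem _, hN s, zero_mem _]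

theorem bockstein_mem_SD (hp : p ≠ 2) {z : Coh p n} (hz : z ∈ SD p n) :
    bockstein p n z ∈ SD p n := by
  let S : Subalgebra (ZMod p) (Coh p n) :=
    { carrier := {z | z ∈ SD p n ∧ bockstein p n z ∈ SD p n}
      mul_mem' := fun ha hb => by
        refine ⟨mul_mem ha.1 hb.1, ?_⟩
        rw [bockstein_mul]
        exact add_mem (mul_mem ha.2 hb.1) (mul_mem (gradeInvol_mem hp ha.1) hb.2)
      add_mem' := fun ha hb => by
        refine ⟨add_mem ha.1 hb.1, ?_⟩
        rw [map_add]
        exact add_mem ha.2 hb.2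
      algebraMap_mem' := fun r => by
        refine ⟨Subalgebra.algebraMap_mem _ _, ?_⟩
        rw [← AlgHom.commutes (incl p n), bockstein_incl]
        exact zero_mem _ }
  refine (SD_le hp (S := S) (fun s => ⟨incl_dicksonCoeff_mem s, ?_⟩) (fun s => ⟨muiGen_mem s, ?_⟩)
    (fun s t => ⟨muiGenPair_mem hp s t, ?_⟩) hz).2
  · rw [bockstein_incl]
    exact zero_mem _
  · exact bockstein_muiGen_mem (N := Subalgebra.toSubmodule (SD p n)) (incl_dicksonCoeff_mem 0) s
  · exact bockstein_muiGenPair_mem hp (N := Subalgebra.toSubmodule (SD p n)) muiGen_mem s t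

theorem SD_isSteenrodClosed (hp : p ≠ 2) :
    IsSteenrodClosed (Subalgebra.toSubmodule (SD p n)) where
  bockstein_mem _ hz := bockstein_mem_SD hp hz
  power_mem k _ hz := power_mem_SD hp hz k

theorem gradeInvol_mem_idealGens (hp : p ≠ 2) {z : Coh p n} (hz : z ∈ idealGens p n) :
    gradeInvol p n z ∈ idealGens p n := by
  refine idealGens_le hp (N := (idealGens p n).comap (gradeInvol p n).toLinearMap) ?_
    (fun s => ?_) (fun t => ?_) hz <;> rw [Submodule.mem_comap, AlgHom.toLinearMap_apply]
  · rw [gradeInvol_incl]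
    exact incl_dicksonCoeff_zero_mem_idealGens
  · rw [gradeInvol_muiGen]
    exact neg_mem (muiGen_mem_idealGens s)
  · rw [gradeInvol_muiGenPair]
    exact muiGenPair_mem_idealGens hp t

theorem bockstein_mem_idealGens (hp : p ≠ 2) {z : Coh p n} (hz : z ∈ idealGens p n) :
    bockstein p n z ∈ idealGens p n := by
  refine idealGens_le hp (N := (idealGens p n).comap (bockstein p n)) ?_
    (fun s => ?_) (fun t => ?_) hz <;> rw [Submodule.mem_comap]
  · rw [bockstein_incl]
    exact zero_mem _
  · exact bockstein_muiGen_mem incl_dicksonCoeff_zero_mem_idealGens s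
  · exact bockstein_muiGenPair_mem hp muiGen_mem_idealGens 0 t

theorem power_muiGenPair_zero_mem (hp : p ≠ 2) (k : ℕ) (t : Fin n) :
    power p n k (muiGenPair p n 0 t) ∈ idealI p n := by
  rw [power_muiGenPair]
  refine sum_mem fun a _ => sum_mem fun b _ => ?_
  obtain rfl | ha := eq_or_ne a 0
  · exact smul_mem_idealI _ (idealGens_le_idealI (muiGenPair_mem_idealGens hp b))
  · obtain ⟨w, hw⟩ := C_dvd_adjugate_powerMatrix (p := p) (dicksonGen p n) ha
    rw [hw, mul_assoc, mul_left_comm, Polynomial.coeff_C_mul, mul_smul]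
    exact (incl_mul (dicksonCoeff p n 0) _).subst (idealI_mul_mem
      (idealGens_le_idealI incl_dicksonCoeff_zero_mem_idealGens)
      (smul_mem_SD _ (muiGenPair_mem hp a b)))

theorem power_mem_of_mem_idealGens (hp : p ≠ 2) (k : ℕ) {z : Coh p n} (hz : z ∈ idealGens p n) :
    power p n k z ∈ idealI p n := by
  refine idealGens_le hp (N := (idealI p n).comap (power p n k)) ?_ (fun s => ?_) (fun t => ?_) hz
  · have hdet : incl p n ((moore p n).det ^ (p - 1)) ∈ idealI p n :=
      (mem_iff_of_eq_units_zsmul exists_incl_det_moore_pow_eq).2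
        (idealGens_le_idealI incl_dicksonCoeff_zero_mem_idealGens)
    rw [← mem_iff_of_eq_units_zsmul exists_incl_det_moore_pow_eq, Submodule.mem_comap,
      power_incl_det_moore_pow]
    exact smul_mem_idealI _ hdet
  · rw [Submodule.mem_comap, power_muiGen]
    exact sum_mem fun t _ => smul_mem_idealI _ (idealGens_le_idealI (muiGen_mem_idealGens t))
  · exact power_muiGenPair_zero_mem hp k t

theorem power_mem_idealI (hp : p ≠ 2) (k : ℕ) {z : Coh p n} (hz : z ∈ idealI p n) :
    power p n k z ∈ idealI p n := by
  suffices idealI p n ≤ ⨅ k, (idealI p n).comap (power p n k) from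
    (Submodule.mem_iInf _).1 (this hz) k
  refine idealI_le (fun z hz => ?_) (fun u hu z hz => ?_) (fun z hz v hv => ?_) <;>
    simp only [Submodule.mem_iInf, Submodule.mem_comap] at hz ⊢ <;> intro k
  · exact power_mem_of_mem_idealGens hp k hz
  · rw [power_mul]
    exact sum_mem fun _ _ => mul_mem_idealI (power_mem_SD hp hu _) (hz _)
  · rw [power_mul]
    exact sum_mem fun _ _ => idealI_mul_mem (hz _) (power_mem_SD hp hv _)

theorem bockstein_mem_idealI (hp : p ≠ 2) {z : Coh p n} (hz : z ∈ idealI p n) :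
    bockstein p n z ∈ idealI p n := by
  let N : Submodule (ZMod p) (Coh p n) := idealI p n ⊓
    (idealI p n).comap (gradeInvol p n).toLinearMap ⊓ (idealI p n).comap (bockstein p n)
  have hN {z : Coh p n} : z ∈ N ↔
      (z ∈ idealI p n ∧ gradeInvol p n z ∈ idealI p n) ∧ bockstein p n z ∈ idealI p n := by
    simp only [N, Submodule.mem_inf, Submodule.mem_comap, AlgHom.toLinearMap_apply]
  suffices idealI p n ≤ N from (hN.1 (this hz)).2
  refine idealI_le (fun z hz => ?_) (fun u hu z hz => ?_) (fun z hz v hv => ?_) <;>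
    rw [hN]
  · exact ⟨⟨idealGens_le_idealI hz, idealGens_le_idealI (gradeInvol_mem_idealGens hp hz)⟩,
      idealGens_le_idealI (bockstein_mem_idealGens hp hz)⟩
  · obtain ⟨⟨hz, hγ⟩, hβ⟩ := hN.1 hz
    rw [map_mul, bockstein_mul]
    exact ⟨⟨mul_mem_idealI hu hz, mul_mem_idealI (gradeInvol_mem hp hu) hγ⟩,
      add_mem (mul_mem_idealI (bockstein_mem_SD hp hu) hz)
        (mul_mem_idealI (gradeInvol_mem hp hu) hβ)⟩
  · obtain ⟨⟨hz, hγ⟩, hβ⟩ := hN.1 hz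
    rw [map_mul, bockstein_mul]
    exact ⟨⟨idealI_mul_mem hz hv, idealI_mul_mem hγ (gradeInvol_mem hp hv)⟩,
      add_mem (idealI_mul_mem hβ hv) (idealI_mul_mem hγ (bockstein_mem_SD hp hv))⟩

theorem idealI_isSteenrodClosed (hp : p ≠ 2) : IsSteenrodClosed (idealI p n) where
  bockstein_mem _ hz := bockstein_mem_idealI hp hz
  power_mem k _ hz := power_mem_idealI hp k hz

end Closure

section Degrees

variable {p n : ℕ}

theorem tmul_mem_degPart {i j d : ℕ} {a : ExteriorAlgebra (ZMod p) (Fin n → ZMod p)}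
    {b : Poly p n} (ha : a ∈ ⋀[ZMod p]^i (Fin n → ZMod p)) (hb : b.IsHomogeneous j)
    (h : i + 2 * j = d) : a ⊗ₜ b ∈ degPart p n d :=
  Submodule.subset_span ⟨i, j, a, b, h, ha, hb, rfl⟩

theorem degPart_mul_degPart_le (a b : ℕ) : degPart p n a * degPart p n b ≤ degPart p n (a + b) := by
  rw [degPart, degPart, Submodule.span_mul_span, Submodule.span_le]
  rintro _ ⟨_, ⟨i, j, u, v, h, hu, hv, rfl⟩, _, ⟨i', j', u', v', h', hu', hv', rfl⟩, rfl⟩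
  have huu' : u * u' ∈ ⋀[ZMod p]^(i + i') (Fin n → ZMod p) := by
    rw [ExteriorAlgebra.exteriorPower, pow_add]
    exact Submodule.mul_mem_mul hu hu'
  exact (Algebra.TensorProduct.tmul_mul_tmul u u' v v').symm.subst (motive := (· ∈ degPart p n _))
    (tmul_mem_degPart huu' (hv.mul hv') (by omega))

theorem mul_mem_degPart {a b : ℕ} {z w : Coh p n} (hz : z ∈ degPart p n a)
    (hw : w ∈ degPart p n b) : z * w ∈ degPart p n (a + b) :=
  degPart_mul_degPart_le a b (Submodule.mul_mem_mul hz hw)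

theorem incl_mem_degPart {j : ℕ} {q : Poly p n} (hq : q.IsHomogeneous j) :
    incl p n q ∈ degPart p n (2 * j) :=
  tmul_mem_degPart (i := 0)
    (by rw [ExteriorAlgebra.exteriorPower, pow_zero]; exact Submodule.one_le.1 le_rfl) hq (by omega)

theorem smul_mem_degPart {j d : ℕ} {q : Poly p n} (hq : q.IsHomogeneous j) {z : Coh p n}
    (hz : z ∈ degPart p n d) : q • z ∈ degPart p n (2 * j + d) := by
  rw [← incl_mul]
  exact mul_mem_degPart (incl_mem_degPart hq) hz

theorem one_mem_degPart_zero : (1 : Coh p n) ∈ degPart p n 0 := by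
  have h := incl_mem_degPart (p := p) (MvPolynomial.isHomogeneous_one (Fin n) (ZMod p))
  rwa [map_one] at h

theorem x_mem_degPart_one (i : Fin n) : x p n i ∈ degPart p n 1 :=
  tmul_mem_degPart (i := 1) (j := 0)
    (by rw [ExteriorAlgebra.exteriorPower, pow_one]; exact LinearMap.mem_range_self _ _)
    (MvPolynomial.isHomogeneous_one _ _) (by omega)

theorem exists_algebraMap_eq_of_mem_degPart_zero {z : Coh p n} (hz : z ∈ degPart p n 0) :
    ∃ c, algebraMap (ZMod p) (Coh p n) c = z := by
  suffices h : degPart p n 0 ≤ LinearMap.range (Algebra.linearMap (ZMod p) (Coh p n)) from h hz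
  refine Submodule.span_le.2 ?_
  rintro _ ⟨i, j, a, b, h, ha, hb, rfl⟩
  obtain ⟨rfl, rfl⟩ : i = 0 ∧ j = 0 := by omega
  rw [ExteriorAlgebra.exteriorPower, pow_zero] at ha
  obtain ⟨r, rfl⟩ := Submodule.mem_one.1 ha
  obtain ⟨c, rfl⟩ : ∃ c, b = C c :=
    ⟨_, MvPolynomial.totalDegree_eq_zero_iff_eq_C.1 (Nat.le_zero.1 hb.totalDegree_le)⟩
  refine ⟨r * c, ?_⟩
  rw [Algebra.linearMap_apply, map_mul, Algebra.TensorProduct.algebraMap_apply,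
    Algebra.TensorProduct.algebraMap_apply', Algebra.TensorProduct.tmul_mul_tmul]
  simp [MvPolynomial.algebraMap_eq]

theorem algebraMapInv_eq_zero_of_mem_exteriorPower {R V : Type*} [CommRing R] [AddCommGroup V]
    [Module R V] {i : ℕ} (hi : i ≠ 0) {a : ExteriorAlgebra R V} (ha : a ∈ ⋀[R]^i V) :
    ExteriorAlgebra.algebraMapInv a = 0 := by
  obtain ⟨i, rfl⟩ := Nat.exists_eq_succ_of_ne_zero hi
  rw [ExteriorAlgebra.exteriorPower, pow_succ'] at ha
  induction ha using Submodule.mul_induction_on' with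
  | mem_mul_mem u hu v _ =>
    obtain ⟨m, rfl⟩ := hu
    simp [ExteriorAlgebra.algebraMapInv]
  | add u hu v hv h1 h2 => rw [map_add, h1, h2, add_zero]

variable (p n) in
/-- The augmentation of `Coh p n`, which kills all the generators `x_i` and `y_i`. -/
def augmentation : Coh p n →ₐ[ZMod p] ZMod p :=
  (MvPolynomial.aeval fun _ => 0).comp (exteriorAug p n)

theorem augmentation_apply (z : Coh p n) :
    augmentation p n z = MvPolynomial.constantCoeff (exteriorAug p n z) := by
  simp [augmentation]

theorem augmentation_algebraMap (c : ZMod p) :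
    augmentation p n (algebraMap (ZMod p) (Coh p n) c) = c := by
  rw [AlgHom.commutes, Algebra.algebraMap_self_apply]

theorem eq_zero_of_mem_degPart_zero {z : Coh p n} (hz : z ∈ degPart p n 0)
    (h0 : augmentation p n z = 0) : z = 0 := by
  obtain ⟨c, rfl⟩ := exists_algebraMap_eq_of_mem_degPart_zero hz
  rw [augmentation_algebraMap] at h0
  rw [h0, map_zero]

theorem augmentation_eq_zero_of_mem_degPart {d : ℕ} (hd : d ≠ 0) {z : Coh p n}
    (hz : z ∈ degPart p n d) : augmentation p n z = 0 := by
  suffices h : degPart p n d ≤ LinearMap.ker (augmentation p n).toLinearMap from h hz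
  refine Submodule.span_le.2 ?_
  rintro _ ⟨i, j, a, b, h, ha, hb, rfl⟩
  rw [SetLike.mem_coe, LinearMap.mem_ker, AlgHom.toLinearMap_apply, augmentation_apply,
    exteriorAug_tmul, map_mul]
  rcases eq_or_ne i 0 with rfl | hi
  · have hb0 : MvPolynomial.constantCoeff b = 0 := by
      rw [MvPolynomial.constantCoeff_eq]
      exact hb.coeff_eq_zero (by simp; omega)
    rw [hb0, mul_zero]
  · rw [algebraMapInv_eq_zero_of_mem_exteriorPower hi ha, map_zero, map_zero, zero_mul]

theorem augmentation_bockstein (z : Coh p n) : augmentation p n (bockstein p n z) = 0 := by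
  induction z using TensorProduct.induction_on with
  | zero => simp
  | add z w hz hw => rw [map_add, map_add, hz, hw, add_zero]
  | tmul a b => simp [bockstein, augmentation_apply, exteriorAug_tmul]

theorem constantCoeff_polyPower (hp : p ≠ 0) (k : ℕ) (b : Poly p n) :
    MvPolynomial.constantCoeff (polyPower p n k b) =
      if k = 0 then MvPolynomial.constantCoeff b else 0 := by
  have h : (Polynomial.mapRingHom MvPolynomial.constantCoeff).comp (totalPower p n).toRingHom =
      Polynomial.C.comp MvPolynomial.constantCoeff :=
    MvPolynomial.ringHom_ext (fun r => by simp [totalPower]) fun i => by simp [totalPower, hp]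
  simpa [Polynomial.coeff_C, polyPower_apply] using
    congrArg (Polynomial.coeff · k) (RingHom.congr_fun h b)

theorem augmentation_power (hp : p ≠ 0) (k : ℕ) (z : Coh p n) :
    augmentation p n (power p n k z) = if k = 0 then augmentation p n z else 0 := by
  induction z using TensorProduct.induction_on with
  | zero => simp
  | add z w hz hw =>
    rw [map_add, map_add, hz, hw]
    split_ifs <;> simp
  | tmul a b =>
    simp only [power_tmul, augmentation_apply, exteriorAug_tmul, map_mul,
      constantCoeff_polyPower hp, mul_ite, mul_zero]

theorem finite_degPart [NeZero p] (d : ℕ) : (degPart p n d : Set (Coh p n)).Finite := by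
  let N : Submodule (ZMod p) (Coh p n) := ⨆ i ∈ Finset.range (d + 1), ⨆ j ∈ Finset.range (d + 1),
    Submodule.map₂ (TensorProduct.mk (ZMod p) _ _) (⋀[ZMod p]^i (Fin n → ZMod p))
      (MvPolynomial.homogeneousSubmodule (Fin n) (ZMod p) j)
  have hN : N.FG := Submodule.fg_biSup _ _ fun i _ => Submodule.fg_biSup _ _ fun j _ =>
    (Module.Finite.iff_fg.1 inferInstance).map₂ _ (MvPolynomial.homogeneousSubmodule_fg ..)
  have hle : degPart p n d ≤ N := by
    refine Submodule.span_le.2 ?_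
    rintro _ ⟨i, j, a, b, h, ha, hb, rfl⟩
    exact Submodule.mem_iSup_of_mem i (Submodule.mem_iSup_of_mem (Finset.mem_range.2 (by omega))
      (Submodule.mem_iSup_of_mem j (Submodule.mem_iSup_of_mem (Finset.mem_range.2 (by omega))
        (Submodule.apply_mem_map₂ _ ha hb))))
  have : Module.Finite (ZMod p) N := Module.Finite.iff_fg.2 hN
  have : Finite N := Module.finite_of_finite (ZMod p)
  exact (Set.toFinite (N : Set (Coh p n))).subset hle

end Degrees

section Homogeneous

theorem isHomogeneous_coeff_prod_X_sub_C {R σ ι : Type*} [CommRing R] (t : Finset ι)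
    {l : ι → MvPolynomial σ R} (hl : ∀ v, (l v).IsHomogeneous 1) {i : ℕ} (hi : i ≤ t.card) :
    ((∏ v ∈ t, (Polynomial.X - Polynomial.C (l v))).coeff i).IsHomogeneous (t.card - i) := by
  have h := Multiset.prod_X_sub_C_coeff (t.val.map l) (k := i) (by simpa using hi)
  rw [Multiset.map_map, Multiset.card_map, Finset.esymm_map_val] at h
  refine (congrArg (MvPolynomial.IsHomogeneous · _) h).mpr ?_
  rw [← map_one C, ← map_neg, ← map_pow]
  refine (MvPolynomial.IsHomogeneous.sum _ _ _ fun s hs => ?_).C_mul _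
  rw [Finset.mem_powersetCard] at hs
  simpa [hs.2] using MvPolynomial.IsHomogeneous.prod s l (fun _ => 1) fun v _ => hl v

theorem isHomogeneous_det {R σ m : Type*} [CommRing R] [Fintype m] [DecidableEq m]
    {A : Matrix m m (MvPolynomial σ R)} {d : m → ℕ} (h : ∀ i j, (A i j).IsHomogeneous (d i)) :
    A.det.IsHomogeneous (∑ i, d i) := by
  rw [Matrix.det_apply']
  refine MvPolynomial.IsHomogeneous.sum _ _ _ fun τ _ => ?_
  rw [← map_intCast (C : R →+* MvPolynomial σ R), ← Equiv.sum_comp τ d]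
  exact (MvPolynomial.IsHomogeneous.prod _ _ _ fun i _ => h _ _).C_mul _

theorem exists_isHomogeneous_adjugate {R σ m : Type*} [CommRing R] [Fintype m] [DecidableEq m]
    {A : Matrix m m (MvPolynomial σ R)} {d : m → ℕ} (h : ∀ i j, (A i j).IsHomogeneous (d i))
    (s : m) : ∃ e, ∀ j, (A.adjugate j s).IsHomogeneous e := by
  refine ⟨∑ i, Function.update d s 0 i, fun j => ?_⟩
  rw [Matrix.adjugate_apply]
  refine isHomogeneous_det fun a b => ?_
  rcases eq_or_ne a s with rfl | ha
  · rw [Matrix.updateRow_self, Function.update_self, Pi.single_apply]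
    split_ifs
    · exact MvPolynomial.isHomogeneous_one _ _
    · exact MvPolynomial.isHomogeneous_zero _ _ _
  · rw [Matrix.updateRow_ne ha, Function.update_of_ne ha]
    exact h a b

variable {p n : ℕ}

theorem isHomogeneous_moore (i j : Fin n) : (moore p n i j).IsHomogeneous (p ^ (i : ℕ)) := by
  rw [moore_apply]
  exact MvPolynomial.isHomogeneous_X_pow _ _

theorem exists_xi_mem_degPart (s : Fin n) : ∃ d, xi p n s ∈ degPart p n d := by
  obtain ⟨e, he⟩ := exists_isHomogeneous_adjugate (isHomogeneous_moore (p := p)) s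
  refine ⟨2 * e + 1, ?_⟩
  rw [xi, exteriorForm_apply]
  exact sum_mem fun j _ => smul_mem_degPart (he j) (x_mem_degPart_one j)

theorem exists_muiGen_mem_degPart (s : Fin n) : ∃ d, muiGen p n s ∈ degPart p n d := by
  obtain ⟨e, he⟩ := exists_xi_mem_degPart (p := p) s
  exact ⟨_, smul_mem_degPart ((isHomogeneous_det isHomogeneous_moore).pow _) he⟩

theorem exists_muiGenPair_mem_degPart (s t : Fin n) : ∃ d, muiGenPair p n s t ∈ degPart p n d := by
  obtain ⟨e, he⟩ := exists_xi_mem_degPart (p := p) s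
  obtain ⟨e', he'⟩ := exists_xi_mem_degPart (p := p) t
  exact ⟨_, smul_mem_degPart ((isHomogeneous_det isHomogeneous_moore).pow _)
    (mul_mem_degPart he he')⟩

theorem isHomogeneous_dicksonCoeff [Fact p.Prime] (s : Fin n) :
    (dicksonCoeff p n s).IsHomogeneous (p ^ n - p ^ (s : ℕ)) := by
  have hlin (v : Fin n → ZMod p) : (linearForm p n v).IsHomogeneous 1 := by
    rw [linearForm_apply]
    exact MvPolynomial.IsHomogeneous.sum _ _ _ fun j _ => by
      rw [MvPolynomial.smul_eq_C_mul]
      exact (MvPolynomial.isHomogeneous_X _ j).C_mul _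
  have hcard : (Finset.univ : Finset (Fin n → ZMod p)).card = p ^ n := by simp [ZMod.card]
  have h := isHomogeneous_coeff_prod_X_sub_C Finset.univ hlin (i := p ^ (s : ℕ))
    (hcard ▸ Nat.pow_le_pow_right (Fact.out : p.Prime).pos s.2.le)
  rw [← dicksonPoly_eq_prod, hcard] at h
  exact h.neg

end Homogeneous

section Graded

variable {p n : ℕ}

/-- A submodule of `Coh p n` is graded if it is the sum of its homogeneous parts; only the
nontrivial inclusion is recorded. -/
def IsGraded (N : Submodule (ZMod p) (Coh p n)) : Prop := N ≤ ⨆ d, N ⊓ degPart p n d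

variable {N N' : Submodule (ZMod p) (Coh p n)}

theorem IsGraded.eq_iSup (hN : IsGraded N) : N = ⨆ d, N ⊓ degPart p n d :=
  hN.antisymm (iSup_le fun _ => inf_le_left)

theorem IsSteenrodSubmodule.isGraded (hN : IsSteenrodSubmodule p n N) : IsGraded N := hN.graded.le

theorem IsGraded.le (hN : IsGraded N) (h : ∀ d, ∀ z ∈ N, z ∈ degPart p n d → z ∈ N') : N ≤ N' :=
  le_trans (α := Submodule (ZMod p) (Coh p n)) hN (iSup_le fun d z hz => h d z hz.1 hz.2)

theorem IsGraded.isSteenrodSubmodule (hN : IsGraded N) (hN' : IsSteenrodClosed N) :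
    IsSteenrodSubmodule p n N :=
  ⟨hN.eq_iSup, hN'.bockstein_mem, hN'.power_mem⟩

theorem mem_iSup_inf_degPart {z : Coh p n} {d : ℕ} (hN : z ∈ N) (hz : z ∈ degPart p n d) :
    z ∈ ⨆ d, N ⊓ degPart p n d :=
  Submodule.mem_iSup_of_mem d ⟨hN, hz⟩

theorem iSup_inf_degPart_mul_le (N N' : Submodule (ZMod p) (Coh p n)) :
    (⨆ d, N ⊓ degPart p n d) * (⨆ d, N' ⊓ degPart p n d) ≤ ⨆ d, N * N' ⊓ degPart p n d := by
  rw [Submodule.iSup_mul]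
  refine iSup_le fun a => ?_
  rw [Submodule.mul_iSup]
  exact iSup_le fun b => le_iSup_of_le (a + b) (le_inf (mul_le_mul' inf_le_left inf_le_left)
    ((mul_le_mul' inf_le_right inf_le_right).trans (degPart_mul_degPart_le a b)))

theorem IsGraded.mul (hN : IsGraded N) (hN' : IsGraded N') : IsGraded (N * N') :=
  (mul_le_mul' hN hN').trans (iSup_inf_degPart_mul_le N N')

theorem IsGraded.sub_algebraMap_augmentation_mem (hN : IsGraded N) {z : Coh p n} (hz : z ∈ N) :
    z - algebraMap (ZMod p) (Coh p n) (augmentation p n z) ∈ ⨆ d, N ⊓ degPart p n (d + 1) := by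
  let φ : Coh p n →ₗ[ZMod p] Coh p n :=
    LinearMap.id - Algebra.linearMap (ZMod p) (Coh p n) ∘ₗ (augmentation p n).toLinearMap
  have hφ (z : Coh p n) : φ z = z - algebraMap (ZMod p) (Coh p n) (augmentation p n z) := rfl
  rw [← hφ, ← Submodule.mem_comap]
  refine hN.le (N' := Submodule.comap φ _) (fun d z hz hzd => ?_) hz
  rw [Submodule.mem_comap, hφ]
  rcases d with _ | d
  · obtain ⟨c, rfl⟩ := exists_algebraMap_eq_of_mem_degPart_zero hzd
    rw [augmentation_algebraMap, sub_self]
    exact zero_mem _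
  · rw [augmentation_eq_zero_of_mem_degPart d.succ_ne_zero hzd, map_zero, sub_zero]
    exact Submodule.mem_iSup_of_mem d ⟨hz, hzd⟩

variable [Fact p.Prime]

theorem SD_isGraded (hp : p ≠ 2) : IsGraded (Subalgebra.toSubmodule (SD p n)) := by
  let T : Submodule (ZMod p) (Coh p n) := ⨆ d, Subalgebra.toSubmodule (SD p n) ⊓ degPart p n d
  have hmul (a b : Coh p n) (ha : a ∈ T) (hb : b ∈ T) : a * b ∈ T := by
    have h := iSup_inf_degPart_mul_le _ _ (Submodule.mul_mem_mul ha hb)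
    rwa [(SD p n).isIdempotentElem_toSubmodule.eq] at h
  have hone : (1 : Coh p n) ∈ T := mem_iSup_inf_degPart (one_mem (SD p n)) one_mem_degPart_zero
  intro z hz
  refine SD_le hp (S := T.toSubalgebra hone hmul) (fun s => ?_) (fun s => ?_) (fun s t => ?_) hz
  · exact mem_iSup_inf_degPart (incl_dicksonCoeff_mem s)
      (incl_mem_degPart (isHomogeneous_dicksonCoeff s))
  · exact mem_iSup_inf_degPart (muiGen_mem s) (exists_muiGen_mem_degPart s).choose_spec
  · exact mem_iSup_inf_degPart (muiGenPair_mem hp s t)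
      (exists_muiGenPair_mem_degPart s t).choose_spec

theorem augmentation_eq_zero_of_mem_augSD {z : Coh p n} (hz : z ∈ augSD p n) :
    augmentation p n z = 0 := by
  have hle : (⨆ d, degPart p n (d + 1)) ≤ LinearMap.ker (augmentation p n).toLinearMap :=
    iSup_le fun d _ => augmentation_eq_zero_of_mem_degPart d.succ_ne_zero
  exact hle hz.2

theorem augSD_eq_iSup (hp : p ≠ 2) :
    augSD p n = ⨆ d, Subalgebra.toSubmodule (SD p n) ⊓ degPart p n (d + 1) := by
  refine le_antisymm (fun z hz => ?_) (le_inf (iSup_le fun _ => inf_le_left)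
    (iSup_mono fun _ => inf_le_right))
  have h := (SD_isGraded hp).sub_algebraMap_augmentation_mem hz.1
  rwa [augmentation_eq_zero_of_mem_augSD hz, map_zero, sub_zero] at h

theorem mem_augSD_iff (hp : p ≠ 2) {z : Coh p n} :
    z ∈ augSD p n ↔ z ∈ SD p n ∧ augmentation p n z = 0 := by
  refine ⟨fun hz => ⟨hz.1, augmentation_eq_zero_of_mem_augSD hz⟩, fun ⟨hz, h0⟩ => ?_⟩
  have h := (SD_isGraded hp).sub_algebraMap_augmentation_mem hz
  rwa [h0, map_zero, sub_zero, ← augSD_eq_iSup hp] at h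

theorem augSD_isGraded (hp : p ≠ 2) : IsGraded (augSD p n) := by
  refine (augSD_eq_iSup hp).le.trans (iSup_le fun d => le_iSup_of_le (d + 1)
    (le_inf ?_ inf_le_right))
  rw [augSD_eq_iSup hp]
  exact le_iSup (fun d => Subalgebra.toSubmodule (SD p n) ⊓ degPart p n (d + 1)) d

theorem augSD_isSteenrodClosed [NeZero n] (hp : p ≠ 2) : IsSteenrodClosed (augSD p n) where
  bockstein_mem z hz := by
    rw [mem_augSD_iff hp] at hz ⊢
    exact ⟨bockstein_mem_SD hp hz.1, augmentation_bockstein z⟩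
  power_mem k z hz := by
    rw [mem_augSD_iff hp] at hz ⊢
    refine ⟨power_mem_SD hp hz.1 k, ?_⟩
    rw [augmentation_power (Fact.out : p.Prime).ne_zero, hz.2, ite_self]

theorem mul_mem_augSD (hp : p ≠ 2) {u z : Coh p n} (hu : u ∈ SD p n) (hz : z ∈ augSD p n) :
    u * z ∈ augSD p n := by
  rw [mem_augSD_iff hp] at hz ⊢
  exact ⟨mul_mem hu hz.1, by rw [map_mul, hz.2, mul_zero]⟩

theorem augSD_mul_mem (hp : p ≠ 2) {z v : Coh p n} (hz : z ∈ augSD p n) (hv : v ∈ SD p n) :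
    z * v ∈ augSD p n := by
  rw [mem_augSD_iff hp] at hz ⊢
  exact ⟨mul_mem hz.1 hv, by rw [map_mul, hz.2, zero_mul]⟩

variable [NeZero n]

theorem SD_isSteenrodSubmodule (hp : p ≠ 2) :
    IsSteenrodSubmodule p n (Subalgebra.toSubmodule (SD p n)) :=
  (SD_isGraded hp).isSteenrodSubmodule (SD_isSteenrodClosed hp)

theorem augSD_isSteenrodSubmodule (hp : p ≠ 2) : IsSteenrodSubmodule p n (augSD p n) :=
  (augSD_isGraded hp).isSteenrodSubmodule (augSD_isSteenrodClosed hp)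

theorem idealGens_isGraded (hp : p ≠ 2) : IsGraded (idealGens p n) := by
  refine idealGens_le hp ?_ (fun s => ?_) fun t => ?_
  · exact mem_iSup_inf_degPart incl_dicksonCoeff_zero_mem_idealGens
      (incl_mem_degPart (isHomogeneous_dicksonCoeff 0))
  · exact mem_iSup_inf_degPart (muiGen_mem_idealGens s) (exists_muiGen_mem_degPart s).choose_spec
  · exact mem_iSup_inf_degPart (muiGenPair_mem_idealGens hp t)
      (exists_muiGenPair_mem_degPart 0 t).choose_spec

theorem idealI_isSteenrodSubmodule (hp : p ≠ 2) : IsSteenrodSubmodule p n (idealI p n) :=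
  (((SD_isGraded hp).mul (idealGens_isGraded hp)).mul (SD_isGraded hp)).isSteenrodSubmodule
    (idealI_isSteenrodClosed hp)

theorem idealGens_le_augSD (hp : p ≠ 2) : idealGens p n ≤ augSD p n := by
  refine idealGens_le hp ?_ (fun s => ?_) fun t => ?_ <;>
    rw [mem_augSD_iff hp, augmentation_apply]
  · exact ⟨incl_dicksonCoeff_mem 0, by rw [exteriorAug_incl, constantCoeff_dicksonCoeff]⟩
  · exact ⟨muiGen_mem s, by rw [exteriorAug_muiGen, map_zero]⟩
  · exact ⟨muiGenPair_mem hp 0 t, by rw [exteriorAug_muiGenPair, map_zero]⟩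

theorem idealI_le_augSD (hp : p ≠ 2) : idealI p n ≤ augSD p n :=
  idealI_le (fun _ hz => idealGens_le_augSD hp hz) (fun _ hu _ hz => mul_mem_augSD hp hu hz)
    fun _ hz _ hv => augSD_mul_mem hp hz hv

end Graded

section Endomorphisms

variable {p n : ℕ} {N : Submodule (ZMod p) (Coh p n)} {f g : N →ₗ[ZMod p] N}

theorem IsSteenrodEnd.one : IsSteenrodEnd (1 : N →ₗ[ZMod p] N) :=
  ⟨fun _ _ h => h, fun _ _ h => h, fun _ _ _ h => h⟩

theorem IsSteenrodEnd.mul (hf : IsSteenrodEnd f) (hg : IsSteenrodEnd g) : IsSteenrodEnd (f * g) :=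
  ⟨fun d z h => hf.map_degree d _ (hg.map_degree d z h),
    fun z w h => hf.map_bockstein _ _ (hg.map_bockstein z w h),
    fun k z w h => hf.map_power k _ _ (hg.map_power k z w h)⟩

theorem IsSteenrodEnd.pow (hf : IsSteenrodEnd f) (m : ℕ) : IsSteenrodEnd (f ^ m) := by
  induction m with
  | zero => exact .one
  | succ m ih => rw [pow_succ]; exact ih.mul hf

theorem IsSteenrodEnd.sub (hf : IsSteenrodEnd f) (hg : IsSteenrodEnd g) :
    IsSteenrodEnd (f - g) where
  map_degree d z h := sub_mem (hf.map_degree d z h) (hg.map_degree d z h)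
  map_bockstein z w h := by
    simp only [LinearMap.sub_apply, Submodule.coe_sub, map_sub, hf.map_bockstein z w h,
      hg.map_bockstein z w h]
  map_power k z w h := by
    simp only [LinearMap.sub_apply, Submodule.coe_sub, map_sub, hf.map_power k z w h,
      hg.map_power k z w h]

theorem finite_setOf_mem_degPart [NeZero p] (N : Submodule (ZMod p) (Coh p n)) (d : ℕ) :
    {z : N | (z : Coh p n) ∈ degPart p n d}.Finite :=
  (finite_degPart d).preimage Subtype.val_injective.injOn

theorem IsSteenrodEnd.isIsoInDegree_of_injOn [NeZero p] (hf : IsSteenrodEnd f) {d : ℕ}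
    (hinj : Set.InjOn f {z | (z : Coh p n) ∈ degPart p n d}) : IsIsoInDegree f d :=
  ((finite_setOf_mem_degPart N d).injOn_iff_bijOn_of_mapsTo (hf.map_degree d)).1 hinj

theorem IsSteenrodEnd.bijective_of_ker_eq_bot [NeZero p] (hN : IsGraded N) (hf : IsSteenrodEnd f)
    (hker : LinearMap.ker f = ⊥) : Function.Bijective f := by
  have hinj : Function.Injective f := LinearMap.ker_eq_bot.1 hker
  have hle : N ≤ (LinearMap.range f).map N.subtype := hN.le fun d z hz hzd => by
    obtain ⟨w, -, hw⟩ := (hf.isIsoInDegree_of_injOn hinj.injOn).surjOn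
      (show (⟨z, hz⟩ : N) ∈ {z : N | (z : Coh p n) ∈ degPart p n d} from hzd)
    exact ⟨f w, LinearMap.mem_range_self _ _, congrArg Subtype.val hw⟩
  refine ⟨hinj, fun z => ?_⟩
  obtain ⟨_, ⟨u, rfl⟩, hu⟩ := hle z.2
  exact ⟨u, Subtype.ext hu⟩

theorem IsIsoInDegree.exists_pow_eq [NeZero p] {r : ℕ} (h : IsIsoInDegree f r) :
    ∃ m ≠ 0, ∀ z : N, (z : Coh p n) ∈ degPart p n r → (f ^ m) z = z := by
  let e : Equiv.Perm {z : N | (z : Coh p n) ∈ degPart p n r} := h.equiv f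
  have : Finite {z : N | (z : Coh p n) ∈ degPart p n r} := finite_setOf_mem_degPart N r
  refine ⟨orderOf e, (orderOf_pos e).ne', fun z hz => ?_⟩
  have hsemiconj : Function.Semiconj Subtype.val e f := fun _ => rfl
  have hiter := (hsemiconj.iterate_right (orderOf e)) ⟨z, hz⟩
  rw [Equiv.Perm.iterate_eq_pow, pow_orderOf_eq_one] at hiter
  rw [Module.End.pow_apply]
  exact hiter.symm

theorem IsSteenrodEnd.augmentation_map_eq_zero (hN : IsGraded N) (hf : IsSteenrodEnd f) {z : N}
    (hz : augmentation p n z = 0) : augmentation p n (f z) = 0 := by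
  let ψ : N →ₗ[ZMod p] ZMod p := (augmentation p n).toLinearMap ∘ₗ N.subtype ∘ₗ f
  suffices h : (⨆ d, N ⊓ degPart p n (d + 1)) ≤ (LinearMap.ker ψ).map N.subtype by
    have hz' := hN.sub_algebraMap_augmentation_mem z.2
    rw [hz, map_zero, sub_zero] at hz'
    obtain ⟨w, hw, hwz⟩ := h hz'
    rwa [← show w = z from Subtype.ext hwz]
  exact iSup_le fun d w hw => ⟨⟨w, hw.1⟩,
    augmentation_eq_zero_of_mem_degPart d.succ_ne_zero (hf.map_degree _ ⟨w, hw.1⟩ hw.2), rfl⟩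

theorem IsSteenrodEnd.augmentation_map (hN : IsGraded N) (h1 : 1 ∈ N) (hf : IsSteenrodEnd f)
    (z : N) : augmentation p n (f z) = augmentation p n z * augmentation p n (f ⟨1, h1⟩) := by
  have h := hf.augmentation_map_eq_zero hN (z := z - augmentation p n z • ⟨1, h1⟩) (by simp)
  rwa [LinearMap.map_sub, LinearMap.map_smul, Submodule.coe_sub, map_sub, Submodule.coe_smul,
    map_smul, smul_eq_mul, sub_eq_zero] at h

/-- The elements of augmentation zero in the kernel of `g`, as a subspace of `Coh p n`. This is
where kernels of different endomorphisms of `N` are compared. -/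
def augKer (g : N →ₗ[ZMod p] N) : Submodule (ZMod p) (Coh p n) :=
  (LinearMap.ker g).map N.subtype ⊓ LinearMap.ker (augmentation p n).toLinearMap

theorem mem_augKer {z : Coh p n} :
    z ∈ augKer g ↔ (∃ hz : z ∈ N, g ⟨z, hz⟩ = 0) ∧ augmentation p n z = 0 := by
  simp [augKer]

theorem augKer_inf_augKer_pow_sub_one {m : ℕ} (hm : m ≠ 0) :
    augKer f ⊓ augKer (f ^ m - 1) = ⊥ := by
  obtain ⟨m, rfl⟩ := Nat.exists_eq_succ_of_ne_zero hm
  refine (Submodule.eq_bot_iff _).2 fun z ⟨hz, hz'⟩ => ?_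
  obtain ⟨⟨hzN, hfz⟩, -⟩ := mem_augKer.1 hz
  obtain ⟨⟨_, hfmz⟩, -⟩ := mem_augKer.1 hz'
  have hpow : (f ^ m.succ) ⟨z, hzN⟩ = 0 := by
    rw [pow_succ, Module.End.mul_apply, hfz, LinearMap.map_zero]
  have h : (0 : N) = ⟨z, hzN⟩ := hpow.symm.trans (sub_eq_zero.1 hfmz)
  exact congrArg Subtype.val h.symm

theorem exists_augKer_pow_sub_one_ne_bot [NeZero p] {r : ℕ} (hr : IsLowestPositiveDegree N r)
    (hfr : IsIsoInDegree f r) : ∃ m ≠ 0, augKer (f ^ m - 1) ≠ ⊥ := by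
  obtain ⟨m, hm, hfm⟩ := hfr.exists_pow_eq
  obtain ⟨z, hz, hz0⟩ := Submodule.exists_mem_ne_zero_of_ne_bot hr.1.2
  refine ⟨m, hm, (Submodule.ne_bot_iff _).2 ⟨z, mem_augKer.2 ⟨⟨hz.1, ?_⟩, ?_⟩, hz0⟩⟩
  · rw [LinearMap.sub_apply, hfm _ hz.2, Module.End.one_apply, sub_self]
  · exact augmentation_eq_zero_of_mem_degPart hr.1.1.ne' hz.2

variable [Fact p.Prime]

theorem IsSteenrodEnd.augKer_isSteenrodClosed (hN : IsSteenrodSubmodule p n N)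
    (hg : IsSteenrodEnd g) : IsSteenrodClosed (augKer g) where
  bockstein_mem z hz := by
    obtain ⟨⟨hzN, hgz⟩, -⟩ := mem_augKer.1 hz
    refine mem_augKer.2 ⟨⟨hN.bockstein_mem z hzN, Subtype.ext ?_⟩, augmentation_bockstein z⟩
    rw [hg.map_bockstein ⟨z, hzN⟩ _ rfl, hgz, Submodule.coe_zero, map_zero]
  power_mem k z hz := by
    obtain ⟨⟨hzN, hgz⟩, haug⟩ := mem_augKer.1 hz
    refine mem_augKer.2 ⟨⟨hN.power_mem k z hzN, Subtype.ext ?_⟩, ?_⟩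
    · rw [hg.map_power k ⟨z, hzN⟩ _ rfl, hgz, Submodule.coe_zero, map_zero]
    · rw [augmentation_power (Fact.out : p.Prime).ne_zero, haug, ite_self]

variable [NeZero n]

theorem IsSteenrodEnd.exists_forall_dicksonCoeff_pow_mem_augKer (hp : p ≠ 2)
    (hN : IsSteenrodSubmodule p n N) (hle : N ≤ Subalgebra.toSubmodule (SD p n))
    (hg : IsSteenrodEnd g) (h0 : augKer g ≠ ⊥) :
    ∃ k, ∀ j ≥ k, incl p n (dicksonCoeff p n 0 ^ p ^ j) ∈ augKer g := by
  refine (hg.augKer_isSteenrodClosed hN).exists_forall_dicksonCoeff_pow_mem hp (fun z hz => ?_)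
    (fun z hz => ?_) h0
  · obtain ⟨⟨hzN, -⟩, -⟩ := mem_augKer.1 hz
    exact exteriorAug_mem hp (hle hzN)
  · rw [← augmentation_apply]
    exact (mem_augKer.1 hz).2

theorem augKer_inf_augKer_ne_bot (hp : p ≠ 2) (hN : IsSteenrodSubmodule p n N)
    (hle : N ≤ Subalgebra.toSubmodule (SD p n)) (hf : IsSteenrodEnd f) (hg : IsSteenrodEnd g)
    (hf0 : augKer f ≠ ⊥) (hg0 : augKer g ≠ ⊥) : augKer f ⊓ augKer g ≠ ⊥ := by
  obtain ⟨k, hk⟩ := hf.exists_forall_dicksonCoeff_pow_mem_augKer hp hN hle hf0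
  obtain ⟨l, hl⟩ := hg.exists_forall_dicksonCoeff_pow_mem_augKer hp hN hle hg0
  refine (Submodule.ne_bot_iff _).2
    ⟨_, ⟨hk (max k l) (le_max_left _ _), hl (max k l) (le_max_right _ _)⟩, ?_⟩
  rw [Ne, map_eq_zero_iff (incl p n) incl_injective]
  exact pow_ne_zero _ dicksonCoeff_zero_ne_zero

variable {r : ℕ}

theorem augKer_eq_bot (hp : p ≠ 2) (hN : IsSteenrodSubmodule p n N)
    (hle : N ≤ Subalgebra.toSubmodule (SD p n)) (hf : IsSteenrodEnd f)
    (hr : IsLowestPositiveDegree N r) (hfr : IsIsoInDegree f r) : augKer f = ⊥ := by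
  by_contra h0
  obtain ⟨m, hm, hm0⟩ := exists_augKer_pow_sub_one_ne_bot hr hfr
  exact augKer_inf_augKer_ne_bot hp hN hle hf ((hf.pow m).sub .one) h0 hm0
    (augKer_inf_augKer_pow_sub_one hm)

theorem eq_zero_of_map_eq_zero (hp : p ≠ 2) (hN : IsSteenrodSubmodule p n N)
    (hle : N ≤ Subalgebra.toSubmodule (SD p n)) (hf : IsSteenrodEnd f)
    (hr : IsLowestPositiveDegree N r) (hfr : IsIsoInDegree f r) {z : N} (hfz : f z = 0)
    (haug : augmentation p n z = 0) : z = 0 := by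
  have h : (z : Coh p n) ∈ augKer f := mem_augKer.2 ⟨⟨z.2, hfz⟩, haug⟩
  rw [augKer_eq_bot hp hN hle hf hr hfr, Submodule.mem_bot] at h
  exact Subtype.ext h

theorem isIsoInDegree_of_pos (hp : p ≠ 2) (hN : IsSteenrodSubmodule p n N)
    (hle : N ≤ Subalgebra.toSubmodule (SD p n)) (hf : IsSteenrodEnd f)
    (hr : IsLowestPositiveDegree N r) (hfr : IsIsoInDegree f r) {d : ℕ} (hd : 0 < d) :
    IsIsoInDegree f d :=
  hf.isIsoInDegree_of_injOn fun z hz w hw hzw => sub_eq_zero.1 <|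
    eq_zero_of_map_eq_zero hp hN hle hf hr hfr ((f.map_sub z w).trans (sub_eq_zero.2 hzw))
      (augmentation_eq_zero_of_mem_degPart hd.ne' (sub_mem hz hw))

theorem isAtomicModule_of_le_augSD (hp : p ≠ 2) (hN : IsSteenrodSubmodule p n N)
    (hle : N ≤ augSD p n) : IsAtomicModule N := fun _ hf _ hr hfr =>
  hf.bijective_of_ker_eq_bot hN.isGraded <| LinearMap.ker_eq_bot'.2 fun _ hfz =>
    eq_zero_of_map_eq_zero hp hN (hle.trans inf_le_left) hf hr hfr hfz
      (augmentation_eq_zero_of_mem_augSD (hle (Subtype.coe_prop _)))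

theorem bijective_iff_map_one_ne_zero (hp : p ≠ 2) (hN : IsSteenrodSubmodule p n N)
    (hle : N ≤ Subalgebra.toSubmodule (SD p n)) (h1 : 1 ∈ N) (hf : IsSteenrodEnd f)
    (hr : IsLowestPositiveDegree N r) (hfr : IsIsoInDegree f r) :
    Function.Bijective f ↔ f ⟨1, h1⟩ ≠ 0 := by
  have hone : (⟨1, h1⟩ : N) ≠ 0 := fun h => one_ne_zero (α := ZMod p) <| by
    rw [← map_one (augmentation p n), show (1 : Coh p n) = 0 from congrArg Subtype.val h, map_zero]
  refine ⟨fun h => (map_ne_zero_iff f h.1).2 hone, fun hf1 => ?_⟩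
  have haug1 : augmentation p n (f ⟨1, h1⟩) ≠ 0 := fun h => hf1 <| Subtype.ext <|
    eq_zero_of_mem_degPart_zero (hf.map_degree 0 ⟨1, h1⟩ one_mem_degPart_zero) h
  refine hf.bijective_of_ker_eq_bot hN.isGraded (LinearMap.ker_eq_bot'.2 fun z hfz => ?_)
  have haug := hf.augmentation_map hN.isGraded h1 z
  rw [hfz, Submodule.coe_zero, map_zero, eq_comm, mul_eq_zero, or_iff_left haug1] at haug
  exact eq_zero_of_map_eq_zero hp hN hle hf hr hfr hfz haug

end Endomorphisms

end DicksonAtomic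

end

theorem mainTheorem6 (p n : ℕ) [Fact p.Prime] (hp : p ≠ 2) (hn : 1 ≤ n) :
    (DicksonAtomic.IsSteenrodSubmodule p n (Subalgebra.toSubmodule (DicksonAtomic.SD p n)) ∧
      DicksonAtomic.IsSteenrodSubmodule p n (DicksonAtomic.augSD p n) ∧
      DicksonAtomic.IsAtomicModule (DicksonAtomic.augSD p n) ∧
      ∀ f : Subalgebra.toSubmodule (DicksonAtomic.SD p n) →ₗ[ZMod p]
          Subalgebra.toSubmodule (DicksonAtomic.SD p n),
        DicksonAtomic.IsSteenrodEnd f →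
        ∀ r, DicksonAtomic.IsLowestPositiveDegree
            (Subalgebra.toSubmodule (DicksonAtomic.SD p n)) r →
          DicksonAtomic.IsIsoInDegree f r →
          (∀ d, 0 < d → DicksonAtomic.IsIsoInDegree f d) ∧
            (Function.Bijective f ↔ f ⟨1, (DicksonAtomic.SD p n).one_mem⟩ ≠ 0)) ∧
    (DicksonAtomic.IsSteenrodSubmodule p n (DicksonAtomic.idealI p n) ∧
      DicksonAtomic.IsAtomicModule (DicksonAtomic.idealI p n)) := by
  have : NeZero n := ⟨by omega⟩
  have hSD := DicksonAtomic.SD_isSteenrodSubmodule (p := p) (n := n) hp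
  have haug := DicksonAtomic.augSD_isSteenrodSubmodule (p := p) (n := n) hp
  have hI := DicksonAtomic.idealI_isSteenrodSubmodule (p := p) (n := n) hp
  refine ⟨⟨hSD, haug, DicksonAtomic.isAtomicModule_of_le_augSD hp haug le_rfl,
    fun f hf r hr hfr => ⟨fun d hd => ?_, ?_⟩⟩,
    hI, DicksonAtomic.isAtomicModule_of_le_augSD hp hI (DicksonAtomic.idealI_le_augSD hp)⟩
  · exact DicksonAtomic.isIsoInDegree_of_pos hp hSD le_rfl hf hr hfr hd
  · exact DicksonAtomic.bijective_iff_map_one_ne_zero hp hSD le_rfl _ hf hr hfr
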